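/- **Setting.** Let $n\ge 1$. A lattice $G\subset\mathbb R^n$ is a discrete subgroup of full rank $n$, and $\mathcal G_m$ is the set of lattices of volume (covolume) $d(G)=|\mathbb R^n/G|=m$. Let $\lambda(G)$ be the length of the shortest nonzero element of $G$. A (Lebesgue measurable) set $D\subset\mathbb R^n$ is a fundamental domain for $G$ if $|\mathbb R^n\setminus\bigcup_{g\in G}(D+g)|=0$ and $|(D+g)\cap(D+h)|=0$ for all $g\neq h$ in $G$. Given a norm $\phi$ on $\mathbb R^n$, put $$\mathrm{Per}_\phi(E)=\int_{\partial^*E}\phi(\nu_E)\,d\mathcal H^{n-1},$$ where $\partial^*E$ is the reduced boundary and $\nu_E$ the measure-theoretic normal, if $E$ is a measurable set of locally finite perimeter, and $\mathrm{Per}_\phi(E)=+\infty$ for all other measurable $E$. A sequence of lattices $G_i$ converges to $G$ in the Kuratowski sense if $$G=\{g\in\mathbb R^n:\limsup_{i\to\infty} d(g,G_i)=0\}=\{g\in\mathbb R^n:\liminf_{i\to\infty} d(g,G_i)=0\}.$$ **Proposition 3.1.** Let $\phi$ be a norm on $\mathbb R^n$ and let $m,C>0$. There is a constant $\delta=\delta(C,\phi,m)>0$,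 which can be taken equal to $2m/C$ in the isotropic case $\phi(x)=|x|$, such that the following holds. Let $(G_i)_{i\in\mathbb N}$ be a sequence of lattices in $\mathcal G_m$ and, for each $i$, let $D_i$ be a fundamental domain for $G_i$ with $\mathrm{Per}_\phi(D_i)\le C$. Then $\lambda(G_i)\ge\delta$ for all $i$. Moreover there are a subsequence $(G_{i_k})_k$ and a lattice $G\in\mathcal G_m$ such that $G_{i_k}\to G$ in the Kuratowski sense as $k\to\infty$. -/

import Mathlib

open MeasureTheory Filter Topology Metric

noncomputable section

/-! ### Lattices -/

/-- A lattice of `ℝⁿ`: a discrete subgroup of full rank `n`, i.e. one which spans `ℝⁿ` over `ℝ`. -/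
def IsLattice {n : ℕ} (G : Submodule ℤ (EuclideanSpace ℝ (Fin n))) : Prop :=
  DiscreteTopology G ∧ Submodule.span ℝ (G : Set (EuclideanSpace ℝ (Fin n))) = ⊤

/-- The set `𝒢_m` of all lattices of `ℝⁿ` of volume `m`. -/
def latticesOfVolume (n : ℕ) (m : ℝ) : Set (Submodule ℤ (EuclideanSpace ℝ (Fin n))) :=
  {G | IsLattice G ∧ ZLattice.covolume G = m}

/-- The minimum distance `λ(G)`: the length of the shortest nonzero element of `G`. -/
def minDistance {n : ℕ} (G : Submodule ℤ (EuclideanSpace ℝ (Fin n))) : ℝ :=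
  sInf {r : ℝ | ∃ g ∈ G, g ≠ 0 ∧ ‖g‖ = r}

/-- Kuratowski convergence of a sequence of lattices to `G`: `G` is both the lower limit
`{g | limsup d(g, Gᵢ) = 0}` and the upper limit `{g | liminf d(g, Gᵢ) = 0}` of the sequence.
(Since `0 ∈ Gᵢ`, the distances `d(g, Gᵢ)` lie in `[0, |g|]`.) -/
def KuratowskiConverges {n : ℕ} (Gs : ℕ → Submodule ℤ (EuclideanSpace ℝ (Fin n)))
    (G : Submodule ℤ (EuclideanSpace ℝ (Fin n))) : Prop :=
  (G : Set (EuclideanSpace ℝ (Fin n))) =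
      {g | limsup (fun i => infDist g (Gs i : Set (EuclideanSpace ℝ (Fin n)))) atTop = 0} ∧
  (G : Set (EuclideanSpace ℝ (Fin n))) =
      {g | liminf (fun i => infDist g (Gs i : Set (EuclideanSpace ℝ (Fin n)))) atTop = 0}

/-! ### Sets of locally finite perimeter, reduced boundary, anisotropic perimeter -/

/-- The divergence of a vector field on `ℝⁿ`. -/
def divergence {n : ℕ} (T : EuclideanSpace ℝ (Fin n) → EuclideanSpace ℝ (Fin n))
    (x : EuclideanSpace ℝ (Fin n)) : ℝ :=
  ∑ i : Fin n, (fderiv ℝ T x (EuclideanSpace.single i 1)) i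

/-- `(μ, ν)` is the polar decomposition of the Gauss–Green measure of `E`: `μ` is a Radon measure
(the total variation of the distributional gradient of the indicator function of `E`), `ν` is a
measurable field of unit vectors (defined `μ`-almost everywhere), and
`∫_E div T dx = ∫ ⟪T, ν⟫ dμ` for all `T ∈ C¹_c(ℝⁿ; ℝⁿ)`. -/
structure IsGaussGreenPair {n : ℕ} (E : Set (EuclideanSpace ℝ (Fin n)))
    (μ : Measure (EuclideanSpace ℝ (Fin n)))
    (ν : EuclideanSpace ℝ (Fin n) → EuclideanSpace ℝ (Fin n)) : Prop where
  locallyFinite : IsLocallyFiniteMeasure μ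
  measurable : Measurable ν
  norm_eq_one : ∀ᵐ x ∂μ, ‖ν x‖ = 1
  integral_divergence : ∀ T : EuclideanSpace ℝ (Fin n) → EuclideanSpace ℝ (Fin n),
    ContDiff ℝ 1 T → HasCompactSupport T →
      ∫ x in E, divergence T x = ∫ x, inner ℝ (T x) (ν x) ∂μ

/-- `E` has locally finite perimeter: the distributional gradient of its indicator function is an
`ℝⁿ`-valued Radon measure. -/
def HasLocallyFinitePerimeter {n : ℕ} (E : Set (EuclideanSpace ℝ (Fin n))) : Prop :=
  ∃ p : Measure (EuclideanSpace ℝ (Fin n)) ×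
      (EuclideanSpace ℝ (Fin n) → EuclideanSpace ℝ (Fin n)), IsGaussGreenPair E p.1 p.2

/-- The perimeter measure of a set of locally finite perimeter. -/
def perimeterMeasure {n : ℕ} {E : Set (EuclideanSpace ℝ (Fin n))}
    (h : HasLocallyFinitePerimeter E) : Measure (EuclideanSpace ℝ (Fin n)) :=
  h.choose.1

/-- The average over the closed ball `B(x, r)` of the polar density of the Gauss–Green measure with
respect to the perimeter measure. The Gauss–Green measure determines the pair `(μ, ν)` up to changing
`ν` on a `μ`-null set, so this quantity depends only on `E`. -/
def averageNormal {n : ℕ} {E : Set (EuclideanSpace ℝ (Fin n))}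
    (h : HasLocallyFinitePerimeter E) (x : EuclideanSpace ℝ (Fin n)) (r : ℝ) :
    EuclideanSpace ℝ (Fin n) :=
  ⨍ y in closedBall x r, h.choose.2 y ∂(perimeterMeasure h)

/-- The measure-theoretic outer normal `ν_E(x) = lim_{r → 0⁺}` of the average normals in `B(x, r)`
(meaningful where this limit exists, in particular on the reduced boundary). -/
def outerNormal {n : ℕ} {E : Set (EuclideanSpace ℝ (Fin n))}
    (h : HasLocallyFinitePerimeter E) (x : EuclideanSpace ℝ (Fin n)) : EuclideanSpace ℝ (Fin n) :=
  limUnder (𝓝[>] (0 : ℝ)) (averageNormal h x)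

/-- De Giorgi's reduced boundary `∂*E`: the points of the support of the perimeter measure at which
the averages of the normal over small balls converge to a unit vector. -/
def reducedBoundary {n : ℕ} {E : Set (EuclideanSpace ℝ (Fin n))}
    (h : HasLocallyFinitePerimeter E) : Set (EuclideanSpace ℝ (Fin n)) :=
  {x | (∀ r : ℝ, 0 < r → 0 < perimeterMeasure h (closedBall x r)) ∧
    ∃ v : EuclideanSpace ℝ (Fin n), ‖v‖ = 1 ∧
      Tendsto (averageNormal h x) (𝓝[>] (0 : ℝ)) (𝓝 v)}

open Classical in
/-- The anisotropic perimeter `Per_φ(E) = ∫_{∂*E} φ(ν_E) dH^{n-1}`, where `H^{n-1}` is the Hausdorff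
measure with the usual normalization; it is `+∞` if `E` is not of locally finite perimeter. -/
def anisotropicPerimeter {n : ℕ} (φ : Seminorm ℝ (EuclideanSpace ℝ (Fin n)))
    (E : Set (EuclideanSpace ℝ (Fin n))) : ENNReal :=
  if h : HasLocallyFinitePerimeter E then
    ∫⁻ x in reducedBoundary h, ENNReal.ofReal (φ (outerNormal h x)) ∂(μHE[n - 1])
  else ⊤

end

/-!
# Lattices with fundamental domains of bounded perimeter

Let `D` be a fundamental domain of a lattice `G` of volume `m`, and let `g ≠ 0` be in `G`. Since
`D + g` and `D` are disjoint up to a null set, `2 m = |D ∆ (D + g)|`, while the right-hand side is at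
most `|g|` times the total mass of the perimeter measure `μ` of `D`
(`IsGaussGreenPair.two_mul_volume_le`). If `c |x| ≤ φ x`, then `c μ(ℝⁿ) ≤ Per_φ(D) ≤ C`
(`mul_perimeterMeasure_univ_le`), so that `|g| ≥ 2 m c / C`, with `c = 1` for the Euclidean norm.

As `Per_φ` is an integral over the reduced boundary with respect to the Hausdorff measure, the second
inequality needs two facts. By the Besicovitch differentiation theorem `μ` is concentrated on the
reduced boundary. Moreover `μ ≤ ℋⁿ⁻¹` with the sharp constant one
(`IsGaussGreenPair.le_euclideanHausdorffMeasure`). This half of De Giorgi's structure theorem is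
proved without blow-ups or rectifiability, as follows. For a unit vector `v`, the net flux of the
Gauss–Green measure in the direction `v` through a cylinder with axis `v` is at most the measure of
its base, by testing with a product of functions of `⟪v, x⟫` and of the projection of `x` to `vᗮ`.
On a set where the normal `ν` satisfies `⟪v, ν⟫ ≥ 0` the opposite flux vanishes, hence is small in a
neighbourhood of a compact part of it; summing over small cylinders, and using that the projection to
`vᗮ` does not increase `ℋⁿ⁻¹`, bounds the flux through the set by its Hausdorff measure. Splitting
the space according to the direction of `ν` bounds `μ` itself.

The compactness statement is then Mahler's theorem (`exists_subseq_kuratowskiConverges`). Along a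
subsequence the distance functions to the lattices converge pointwise, and the limit lattice is the
zero set of the limit function. The covering radii are bounded by a packing argument, so the limit
has full rank. Its volume is `m`, because compact packings of the limit are packings of some lattice
of the sequence, and neighbourhoods of compact coverings for the limit are coverings for some lattice
of the sequence.
-/

open MeasureTheory Filter Topology Metric
open scoped NNReal ENNReal RealInnerProductSpace Pointwise

/-! ### Fluxes through slabs -/

/-- A compact set can be separated from the complement of its `r`-thickening by a compactly
supported smooth function with values in `[0, 1]`. -/
theorem IsCompact.exists_contDiff_bump {V : Type*} [NormedAddCommGroup V] [NormedSpace ℝ V]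
    [FiniteDimensional ℝ V] {K : Set V} (hK : IsCompact K) {r : ℝ} (hr : 0 < r) :
    ∃ f : V → ℝ, ContDiff ℝ 1 f ∧ HasCompactSupport f ∧ (∀ x, 0 ≤ f x) ∧ (∀ x, f x ≤ 1) ∧
      (∀ x ∈ K, f x = 1) ∧ ∀ x ∉ thickening r K, f x = 0 := by
  obtain ⟨f, h0, h1, h01⟩ := exists_contMDiffMap_zero_one_of_isClosed (n := 1)
    (modelWithCornersSelf ℝ V)
    (s := (thickening r K)ᶜ) (t := K) isOpen_thickening.isClosed_compl hK.isClosed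
    (Set.disjoint_left.2 fun x hx hxK => hx (self_subset_thickening hr K hxK))
  refine ⟨f, f.contMDiff.contDiff, ?_, fun x => (h01 x).1, fun x => (h01 x).2, fun x hx => h1 hx,
    fun x hx => h0 hx⟩
  refine HasCompactSupport.intro (hK.cthickening (r := r)) fun x hx => h0 fun hx' =>
    hx (thickening_subset_cthickening r K hx')

theorem divergence_smul_const {n : ℕ} {f : EuclideanSpace ℝ (Fin n) → ℝ} (hf : Differentiable ℝ f)
    (v x : EuclideanSpace ℝ (Fin n)) : divergence (fun y => f y • v) x = fderiv ℝ f x v := by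
  have h : ∀ i, (fderiv ℝ (fun y => f y • v) x (EuclideanSpace.single i 1)) i =
      fderiv ℝ f x (v i • EuclideanSpace.single i 1) := by
    intro i
    rw [fderiv_smul_const (hf x)]
    simp [mul_comm]
  simp only [divergence, h, ← map_sum]
  congr 1
  ext j
  simp [Pi.single_apply]

/-- The Gauss–Green formula for directional derivatives. -/
theorem IsGaussGreenPair.integral_fderiv {n : ℕ} {E : Set (EuclideanSpace ℝ (Fin n))}
    {μ : Measure (EuclideanSpace ℝ (Fin n))}
  {ν : EuclideanSpace ℝ (Fin n) → EuclideanSpace ℝ (Fin n)}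
    (h : IsGaussGreenPair E μ ν) {f : EuclideanSpace ℝ (Fin n) → ℝ} (hf : ContDiff ℝ 1 f)
    (hfc : HasCompactSupport f) (v : EuclideanSpace ℝ (Fin n)) :
    ∫ x in E, fderiv ℝ f x v = ∫ x, f x * ⟪v, ν x⟫ ∂μ := by
  have := h.integral_divergence (fun y => f y • v) (hf.smul contDiff_const) hfc.smul_right
  simpa only [divergence_smul_const (hf.differentiable one_ne_zero), real_inner_smul_left] using this

/-- Fubini's theorem in the orthogonal coordinates `(⟪v, x⟫, P x)`, where `P` is the projection onto
the orthogonal complement of the unit vector `v`. -/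
theorem integral_inner_mul_orthogonalProjection {n : ℕ} {v : EuclideanSpace ℝ (Fin n)}
    (hv : ‖v‖ = 1) (a : ℝ → ℝ) (g : (ℝ ∙ v)ᗮ → ℝ) :
    ∫ x, a ⟪v, x⟫ * g ((ℝ ∙ v)ᗮ.orthogonalProjectionOnto x) = (∫ t, a t) * ∫ y, g y := by
  let e : ℝ ≃ₗᵢ[ℝ] (ℝ ∙ v) := LinearIsometryEquiv.toSpanUnitSingleton v hv
  let D := (ℝ ∙ v).orthogonalDecomposition
  have he : ∀ x, ⟪v, x⟫ = e.symm ((ℝ ∙ v).orthogonalProjectionOnto x) := by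
    intro x
    rw [LinearIsometryEquiv.eq_symm_apply]
    ext1
    exact (Submodule.starProjection_unit_singleton ℝ hv x).symm
  have h1 := D.measurePreserving.integral_comp D.toHomeomorph.measurableEmbedding
    (fun z => a (e.symm z.fst) * g z.snd)
  have h2 := (WithLp.volume_preserving_ofLp (ℝ ∙ v) (ℝ ∙ v)ᗮ).integral_comp
    (MeasurableEquiv.toLp 2 ((ℝ ∙ v) × (ℝ ∙ v)ᗮ)).symm.measurableEmbedding
    (fun z => a (e.symm z.1) * g z.2)
  have h3 := e.symm.measurePreserving.integral_comp e.symm.toHomeomorph.measurableEmbedding a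
  rw [← h3, ← integral_prod_mul (fun z => a (e.symm z)) g]
  refine Eq.trans ?_ (h1.trans h2)
  refine integral_congr_ae (Eventually.of_forall fun x => ?_)
  simp [D, he, Submodule.orthogonalDecomposition_apply]

theorem hasCompactSupport_inner_mul_orthogonalProjection {n : ℕ} {v : EuclideanSpace ℝ (Fin n)}
    (hv : ‖v‖ = 1) {a : ℝ → ℝ} {g : (ℝ ∙ v)ᗮ → ℝ}
    (hac : HasCompactSupport a) (hgc : HasCompactSupport g) :
    HasCompactSupport (fun x => a ⟪v, x⟫ * g ((ℝ ∙ v)ᗮ.orthogonalProjectionOnto x)) := by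
  -- the support is the image of a compact set under `(t, y) ↦ t • v + y`
  refine HasCompactSupport.intro (K := (fun p : ℝ × (ℝ ∙ v)ᗮ => p.1 • v + (p.2 : _)) ''
    (tsupport a ×ˢ tsupport g)) ((hac.isCompact.prod hgc.isCompact).image (by fun_prop)) ?_
  intro x hx
  by_contra h
  rw [mul_eq_zero, not_or] at h
  refine hx ⟨(⟪v, x⟫, (ℝ ∙ v)ᗮ.orthogonalProjectionOnto x),
    ⟨subset_tsupport a h.1, subset_tsupport g h.2⟩, ?_⟩
  have := (ℝ ∙ v).starProjection_add_starProjection_orthogonal x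
  rwa [Submodule.starProjection_unit_singleton ℝ hv] at this

/-- A smooth plateau function `h` for the interval `[a, b]` whose derivative is bounded above by a
continuous function `k ≥ 0` of integral one (the derivative of the ascending part of `h`). -/
theorem exists_plateau (a b : ℝ) {r : ℝ} (hr : 0 < r) :
    ∃ h k : ℝ → ℝ, ContDiff ℝ 1 h ∧ HasCompactSupport h ∧ (∀ t, 0 ≤ h t) ∧ (∀ t, h t ≤ 1) ∧
      (∀ t ∈ Set.Icc a b, h t = 1) ∧ (∀ t ∉ Set.Icc (a - r) (b + r), h t = 0) ∧
      Continuous k ∧ HasCompactSupport k ∧ (∀ t, 0 ≤ k t) ∧ (∀ t, deriv h t ≤ k t) ∧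
      ∫ t, k t = 1 := by
  let u : ℝ → ℝ := fun t => Real.smoothTransition ((t - a) / r + 1)
  let w : ℝ → ℝ := fun t => Real.smoothTransition ((b - t) / r + 1)
  have hu : ContDiff ℝ 1 u := Real.smoothTransition.contDiff.comp (by fun_prop)
  have hw : ContDiff ℝ 1 w := Real.smoothTransition.contDiff.comp (by fun_prop)
  have hum : Monotone u := fun s t hst => Real.smoothTransition.monotone (by gcongr)
  have hwm : Antitone w := fun s t hst => Real.smoothTransition.monotone (by gcongr)
  have hu0 : ∀ t ≤ a - r, u t = 0 := fun t ht =>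
    Real.smoothTransition.zero_of_nonpos (by
      have : (t - a) / r ≤ -1 := by rw [div_le_iff₀ hr]; linarith
      linarith)
  have hu1 : ∀ t, a ≤ t → u t = 1 := fun t ht =>
    Real.smoothTransition.one_of_one_le (by
      have : 0 ≤ (t - a) / r := div_nonneg (by linarith) hr.le
      linarith)
  have hw0 : ∀ t, b + r ≤ t → w t = 0 := fun t ht =>
    Real.smoothTransition.zero_of_nonpos (by
      have : (b - t) / r ≤ -1 := by rw [div_le_iff₀ hr]; linarith
      linarith)
  have hw1 : ∀ t ≤ b, w t = 1 := fun t ht =>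
    Real.smoothTransition.one_of_one_le (by
      have : 0 ≤ (b - t) / r := div_nonneg (by linarith) hr.le
      linarith)
  have hout : ∀ t ∉ Set.Icc (a - r) (b + r), u t * w t = 0 := by
    intro t ht
    rcases lt_or_ge t (a - r) with h | h
    · rw [hu0 t h.le, zero_mul]
    · rw [hw0 t (le_of_lt (lt_of_not_ge fun h' => ht ⟨h, h'⟩)), mul_zero]
  have hud : ∀ t, HasDerivAt u (deriv u t) t := fun t =>
    (hu.differentiable one_ne_zero t).hasDerivAt
  have hwd : ∀ t, HasDerivAt w (deriv w t) t := fun t =>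
    (hw.differentiable one_ne_zero t).hasDerivAt
  have hk0 : ∀ t ∉ Set.Icc (a - r) a, deriv u t = 0 := by
    intro t ht
    rcases lt_or_ge t (a - r) with h | h
    · have : u =ᶠ[𝓝 t] fun _ => 0 := by
        filter_upwards [Iio_mem_nhds h] with s hs using hu0 s (le_of_lt hs)
      rw [this.deriv_eq, deriv_const]
    · have : u =ᶠ[𝓝 t] fun _ => 1 := by
        filter_upwards [Ioi_mem_nhds (lt_of_not_ge fun h' => ht ⟨h, h'⟩)] with s hs
          using hu1 s (le_of_lt hs)
      rw [this.deriv_eq, deriv_const]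
  have hkc : Continuous (deriv u) := hu.continuous_deriv le_rfl
  have hks : HasCompactSupport (deriv u) := HasCompactSupport.intro isCompact_Icc hk0
  refine ⟨fun t => u t * w t, deriv u, hu.mul hw, HasCompactSupport.intro isCompact_Icc hout,
    fun t => mul_nonneg (Real.smoothTransition.nonneg _) (Real.smoothTransition.nonneg _),
    fun t => mul_le_one₀ (Real.smoothTransition.le_one _) (Real.smoothTransition.nonneg _)
      (Real.smoothTransition.le_one _),
    fun t ht => by simp only [hu1 t ht.1, hw1 t ht.2, mul_one], hout, hkc, hks,
    fun t => hum.deriv_nonneg, fun t => ?_, ?_⟩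
  · rw [((hud t).fun_mul (hwd t)).deriv]
    have h1 : deriv u t * w t ≤ deriv u t :=
      mul_le_of_le_one_right hum.deriv_nonneg (Real.smoothTransition.le_one _)
    have h2 : u t * deriv w t ≤ 0 :=
      mul_nonpos_of_nonneg_of_nonpos (Real.smoothTransition.nonneg _) hwm.deriv_nonpos
    linarith
  · have h := integral_of_hasDerivAt_of_tendsto hud (hkc.integrable_of_hasCompactSupport hks)
      (m := 0) (n := 1)
      (tendsto_const_nhds.congr' ((eventually_le_atBot (a - r)).mono fun t ht => (hu0 t ht).symm))
      (tendsto_const_nhds.congr' ((eventually_ge_atTop a).mono fun t ht => (hu1 t ht).symm))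
    simpa using h

/-- The flux of the Gauss–Green measure through a slab, tested against a function `g ≥ 0`
of the transversal variable, is at most the integral of `g`: on each line in the direction `v` the
derivative of the plateau function `h` integrates to at most one over any subset of the line. -/
theorem IsGaussGreenPair.integral_slab_le {n : ℕ} {E : Set (EuclideanSpace ℝ (Fin n))}
    {μ : Measure (EuclideanSpace ℝ (Fin n))}
  {ν : EuclideanSpace ℝ (Fin n) → EuclideanSpace ℝ (Fin n)}
    (hE : IsGaussGreenPair E μ ν) {v : EuclideanSpace ℝ (Fin n)} (hv : ‖v‖ = 1)
    {g : (ℝ ∙ v)ᗮ → ℝ} (hg : ContDiff ℝ 1 g) (hgc : HasCompactSupport g) (hg0 : ∀ y, 0 ≤ g y)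
    {h k : ℝ → ℝ} (hh : ContDiff ℝ 1 h) (hhc : HasCompactSupport h) (hk : Continuous k)
    (hkc : HasCompactSupport k) (hk0 : ∀ t, 0 ≤ k t) (hhk : ∀ t, deriv h t ≤ k t)
    (hk1 : ∫ t, k t = 1) :
    ∫ x, h ⟪v, x⟫ * g ((ℝ ∙ v)ᗮ.orthogonalProjectionOnto x) * ⟪v, ν x⟫ ∂μ ≤ ∫ y, g y := by
  set P := (ℝ ∙ v)ᗮ.orthogonalProjectionOnto with hP
  have hgP : ContDiff ℝ 1 fun x => g (P x) := hg.comp P.contDiff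
  have hhv : ContDiff ℝ 1 fun x => h ⟪v, x⟫ := hh.comp (contDiff_const.inner ℝ contDiff_id)
  have hfc := hasCompactSupport_inner_mul_orthogonalProjection hv hhc hgc
  rw [← hE.integral_fderiv (hhv.mul hgP) hfc v]
  have hPv : P v = 0 := by
    exact Submodule.orthogonalProjectionOnto_eq_zero_iff.2
      (Submodule.le_orthogonal_orthogonal _ (Submodule.mem_span_singleton_self v))
  have hfd : ∀ x, fderiv ℝ (fun x => h ⟪v, x⟫ * g (P x)) x v = deriv h ⟪v, x⟫ * g (P x) := by
    intro x
    -- along the line `x + s v` the factor `g (P ·)` is constant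
    have hlin : HasDerivAt (fun s : ℝ => x + s • v) v 0 := by
      simpa using ((hasDerivAt_id (0 : ℝ)).smul_const v).const_add x
    have h1 := ((hhv.mul hgP).differentiable one_ne_zero
      (x + (0 : ℝ) • v)).hasFDerivAt.comp_hasDerivAt (0 : ℝ) hlin
    have hs : ((fun x => h ⟪v, x⟫ * g (P x)) ∘ fun s : ℝ => x + s • v) =
        fun s => h (⟪v, x⟫ + s) * g (P x) := by
      ext s
      simp [inner_add_right, real_inner_smul_right, hv, hPv]
    rw [hs] at h1
    have h2 : HasDerivAt (fun s => h (⟪v, x⟫ + s) * g (P x)) (deriv h ⟪v, x⟫ * g (P x)) 0 := by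
      have h3 : HasDerivAt h (deriv h ⟪v, x⟫) (⟪v, x⟫ + 0) := by
        simpa using (hh.differentiable one_ne_zero ⟪v, x⟫).hasDerivAt
      simpa using (h3.comp_const_add ⟪v, x⟫ 0).mul_const (g (P x))
    simpa using h1.unique h2
  simp only [hfd]
  have hi1 : Integrable fun x => deriv h ⟪v, x⟫ * g (P x) :=
    Continuous.integrable_of_hasCompactSupport
      (((hh.continuous_deriv le_rfl).comp (by fun_prop)).mul hgP.continuous)
      (hasCompactSupport_inner_mul_orthogonalProjection hv hhc.deriv hgc)
  have hi2 : Integrable fun x => k ⟪v, x⟫ * g (P x) :=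
    Continuous.integrable_of_hasCompactSupport
      ((hk.comp (by fun_prop)).mul hgP.continuous)
      (hasCompactSupport_inner_mul_orthogonalProjection hv hkc hgc)
  calc ∫ x in E, deriv h ⟪v, x⟫ * g (P x)
      ≤ ∫ x in E, k ⟪v, x⟫ * g (P x) :=
        integral_mono hi1.integrableOn hi2.integrableOn fun x =>
          mul_le_mul_of_nonneg_right (hhk _) (hg0 _)
    _ ≤ ∫ x, k ⟪v, x⟫ * g (P x) :=
        setIntegral_le_integral hi2 (Eventually.of_forall fun x => mul_nonneg (hk0 _) (hg0 _))
    _ = ∫ y, g y := by rw [hP, integral_inner_mul_orthogonalProjection hv, hk1, one_mul]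

/-! ### Fluxes through cylinders -/

/-- The positive part `⟪v, ν⟫⁺ μ` of the component of the vector measure `ν μ` in the direction `v`;
the negative part is the one in the direction `-v`. -/
noncomputable def directionalFlux {n : ℕ} (μ : Measure (EuclideanSpace ℝ (Fin n)))
    (ν : EuclideanSpace ℝ (Fin n) → EuclideanSpace ℝ (Fin n)) (v : EuclideanSpace ℝ (Fin n)) :
    Measure (EuclideanSpace ℝ (Fin n)) :=
  μ.withDensity fun x => ENNReal.ofReal ⟪v, ν x⟫

section
variable {n : ℕ} {E : Set (EuclideanSpace ℝ (Fin n))}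
  {μ : Measure (EuclideanSpace ℝ (Fin n))}
  {ν : EuclideanSpace ℝ (Fin n) → EuclideanSpace ℝ (Fin n)}
  {v : EuclideanSpace ℝ (Fin n)}

theorem IsGaussGreenPair.abs_inner_le_one (hE : IsGaussGreenPair E μ ν) (hv : ‖v‖ = 1) :
    ∀ᵐ x ∂μ, |⟪v, ν x⟫| ≤ 1 := by
  filter_upwards [hE.norm_eq_one] with x hx
  simpa [hv, hx] using abs_real_inner_le_norm v (ν x)

theorem IsGaussGreenPair.directionalFlux_le (hE : IsGaussGreenPair E μ ν) (hv : ‖v‖ = 1) :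
    directionalFlux μ ν v ≤ μ := by
  conv_rhs => rw [← withDensity_one (μ := μ)]
  refine withDensity_mono ?_
  filter_upwards [hE.abs_inner_le_one hv] with x hx
  simpa using (abs_le.1 hx).2

theorem IsGaussGreenPair.isLocallyFiniteMeasure_directionalFlux (hE : IsGaussGreenPair E μ ν)
    (hv : ‖v‖ = 1) : IsLocallyFiniteMeasure (directionalFlux μ ν v) :=
  have := hE.locallyFinite
  Measure.isLocallyFiniteMeasure_of_le (hE.directionalFlux_le hv)

/-- The cylinder over `B ⊆ vᗮ` between the heights in `I`. -/
def cylinder (v : EuclideanSpace ℝ (Fin n)) (B : Set (ℝ ∙ v)ᗮ) (I : Set ℝ) :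
    Set (EuclideanSpace ℝ (Fin n)) :=
  {x | (ℝ ∙ v)ᗮ.orthogonalProjectionOnto x ∈ B ∧ ⟪v, x⟫ ∈ I}

theorem cylinder_mono {B B' : Set (ℝ ∙ v)ᗮ} {I I' : Set ℝ} (hB : B ⊆ B') (hI : I ⊆ I') :
    cylinder v B I ⊆ cylinder v B' I' := fun _ hx => ⟨hB hx.1, hI hx.2⟩

theorem isClosed_cylinder {B : Set (ℝ ∙ v)ᗮ} {I : Set ℝ} (hB : IsClosed B) (hI : IsClosed I) :
    IsClosed (cylinder v B I) :=
  (hB.preimage (by fun_prop)).inter (hI.preimage (by fun_prop))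

theorem measurableSet_cylinder {B : Set (ℝ ∙ v)ᗮ} {I : Set ℝ} (hB : MeasurableSet B)
    (hI : MeasurableSet I) : MeasurableSet (cylinder v B I) :=
  (hB.preimage (by fun_prop)).inter (hI.preimage (by fun_prop))

/-- Pythagoras in the coordinates `⟪v, x⟫` and projection to `vᗮ`. -/
theorem dist_sq_eq_of_unit (hv : ‖v‖ = 1) (x y : EuclideanSpace ℝ (Fin n)) :
    dist x y ^ 2 = dist ⟪v, x⟫ ⟪v, y⟫ ^ 2 + dist ((ℝ ∙ v)ᗮ.orthogonalProjectionOnto x)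
      ((ℝ ∙ v)ᗮ.orthogonalProjectionOnto y) ^ 2 := by
  have h := (ℝ ∙ v).norm_sq_eq_add_norm_sq_starProjection (x - y)
  rw [Submodule.starProjection_unit_singleton ℝ hv, norm_smul, hv, mul_one] at h
  rw [dist_eq_norm, dist_eq_norm, dist_eq_norm, ← inner_sub_right, ← map_sub, h]
  rfl

theorem isCompact_cylinder (hv : ‖v‖ = 1) {B : Set (ℝ ∙ v)ᗮ} {I : Set ℝ} (hB : IsCompact B)
    (hI : IsCompact I) : IsCompact (cylinder v B I) := by
  refine isCompact_of_isClosed_isBounded (isClosed_cylinder hB.isClosed hI.isClosed) ?_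
  obtain ⟨R, hR⟩ := hB.isBounded.subset_closedBall 0
  obtain ⟨R', hR'⟩ := hI.isBounded.subset_closedBall 0
  refine (isBounded_closedBall (x := (0 : EuclideanSpace ℝ (Fin n))) (r := R' + R)).subset ?_
  intro x hx
  have h := dist_sq_eq_of_unit hv x 0
  have h1 := mem_closedBall.1 (hR hx.1)
  have h2 := mem_closedBall.1 (hR' hx.2)
  simp only [inner_zero_right, map_zero] at h
  rw [mem_closedBall]
  have h3 : 0 ≤ dist ⟪v, x⟫ 0 := dist_nonneg
  have h4 : 0 ≤ dist ((ℝ ∙ v)ᗮ.orthogonalProjectionOnto x) 0 := dist_nonneg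
  refine abs_le_of_sq_le_sq' ?_ (by linarith) |>.2
  rw [h]
  nlinarith

/-- The slab estimate in terms of measures, with room for the smoothing of indicator functions. -/
theorem IsGaussGreenPair.directionalFlux_cylinder_le_cthickening (hE : IsGaussGreenPair E μ ν)
    (hv : ‖v‖ = 1) {H : Set (ℝ ∙ v)ᗮ} (hH : IsCompact H) (a b : ℝ) {r : ℝ} (hr : 0 < r) :
    directionalFlux μ ν v (cylinder v H (Set.Icc a b)) ≤
      directionalFlux μ ν (-v) (cylinder v (cthickening r H) (Set.Icc (a - r) (b + r))) +
        volume (cthickening r H) := by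
  have := hE.locallyFinite
  obtain ⟨g, hg, hgc, hg0, hg1, hgH, hgout⟩ := hH.exists_contDiff_bump hr
  obtain ⟨h, k, hh, hhc, hh0, hh1, hhI, hhout, hk, hkc, hk0, hhk, hk1⟩ := exists_plateau a b hr
  have key := hE.integral_slab_le hv hg hgc hg0 hh hhc hk hkc hk0 hhk hk1
  set P := (ℝ ∙ v)ᗮ.orthogonalProjectionOnto with hP
  set f : EuclideanSpace ℝ (Fin n) → ℝ := fun x => h ⟪v, x⟫ * g (P x) with hf
  have hfm : Continuous f := (hh.continuous.comp (by fun_prop)).mul (hg.continuous.comp (by fun_prop))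
  have hf0 : ∀ x, 0 ≤ f x := fun x => mul_nonneg (hh0 _) (hg0 _)
  have hf1 : ∀ x, f x ≤ 1 := fun x => mul_le_one₀ (hh1 _) (hg0 _) (hg1 _)
  have hfi : Integrable f μ := hfm.integrable_of_hasCompactSupport
    (hasCompactSupport_inner_mul_orthogonalProjection hv hhc hgc)
  have hνm := hE.measurable
  have hωm : ∀ w : EuclideanSpace ℝ (Fin n), Measurable fun x => ⟪w, ν x⟫ := fun w => by fun_prop
  have hint : ∀ w : EuclideanSpace ℝ (Fin n), ‖w‖ = 1 → Integrable (fun x => f x * max ⟪w, ν x⟫ 0) μ := by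
    intro w hw
    refine hfi.mul_bdd (c := 1) ((hωm w).max measurable_const).aestronglyMeasurable ?_
    filter_upwards [hE.abs_inner_le_one hw] with x hx
    rw [Real.norm_eq_abs, abs_of_nonneg (le_max_right _ _)]
    exact max_le (abs_le.1 hx).2 zero_le_one
  have hv' : ‖-v‖ = 1 := by rwa [norm_neg]
  have hle : ∫ x, f x * max ⟪v, ν x⟫ 0 ∂μ ≤ ∫ x, f x * max ⟪-v, ν x⟫ 0 ∂μ + ∫ y, g y := by
    rw [← sub_le_iff_le_add', ← integral_sub (hint v hv) (hint (-v) hv')]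
    refine le_trans (le_of_eq ?_) key
    refine integral_congr_ae (Eventually.of_forall fun x => ?_)
    simp only [inner_neg_left, ← mul_sub]
    congr 1
    rcases le_total 0 ⟪v, ν x⟫ with h | h
    · rw [max_eq_left h, max_eq_right (by linarith), sub_zero]
    · rw [max_eq_right h, max_eq_left (by linarith)]; ring
  have hlint : ∀ w : EuclideanSpace ℝ (Fin n), ‖w‖ = 1 →
      ENNReal.ofReal (∫ x, f x * max ⟪w, ν x⟫ 0 ∂μ) =
        ∫⁻ x, ENNReal.ofReal (f x) ∂(directionalFlux μ ν w) := by
    intro w hw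
    rw [ofReal_integral_eq_lintegral_ofReal (hint w hw)
      (Eventually.of_forall fun x => mul_nonneg (hf0 x) (le_max_right _ _)), directionalFlux,
      lintegral_withDensity_eq_lintegral_mul _ (by fun_prop) (by fun_prop)]
    refine lintegral_congr fun x => ?_
    rw [ENNReal.ofReal_mul (hf0 x), Pi.mul_apply, mul_comm, ENNReal.ofReal_max, ENNReal.ofReal_zero]
    simp
  have h1 : directionalFlux μ ν v (cylinder v H (Set.Icc a b)) ≤
      ∫⁻ x, ENNReal.ofReal (f x) ∂(directionalFlux μ ν v) := by
    rw [← lintegral_indicator_one (measurableSet_cylinder hH.measurableSet measurableSet_Icc)]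
    refine lintegral_mono fun x => ?_
    by_cases hx : x ∈ cylinder v H (Set.Icc a b)
    · rw [Set.indicator_of_mem hx, hf]
      simp only [hhI _ hx.2]
      rw [hgH _ hx.1]
      simp
    · rw [Set.indicator_of_notMem hx]; exact zero_le
  have h2 : ∫⁻ x, ENNReal.ofReal (f x) ∂(directionalFlux μ ν (-v)) ≤
      directionalFlux μ ν (-v) (cylinder v (cthickening r H) (Set.Icc (a - r) (b + r))) := by
    rw [← lintegral_indicator_one (measurableSet_cylinder
      (isClosed_cthickening.measurableSet) measurableSet_Icc)]
    refine lintegral_mono fun x => ?_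
    by_cases hx : x ∈ cylinder v (cthickening r H) (Set.Icc (a - r) (b + r))
    · rw [Set.indicator_of_mem hx]
      simpa using hf1 x
    · have : f x = 0 := by
        by_contra h0
        rw [hf, mul_eq_zero, not_or] at h0
        refine hx ⟨?_, ?_⟩
        · by_contra h'
          exact h0.2 (hgout _ fun h'' => h' (thickening_subset_cthickening _ _ h''))
        · by_contra h'
          exact h0.1 (hhout _ h')
      rw [this, ENNReal.ofReal_zero]; exact zero_le
  have h3 : ENNReal.ofReal (∫ y, g y) ≤ volume (cthickening r H) := by
    rw [ofReal_integral_eq_lintegral_ofReal (hg.continuous.integrable_of_hasCompactSupport hgc)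
      (Eventually.of_forall hg0), ← lintegral_indicator_one isClosed_cthickening.measurableSet]
    refine lintegral_mono fun y => ?_
    by_cases hy : y ∈ cthickening r H
    · rw [Set.indicator_of_mem hy]
      simpa using hg1 y
    · rw [hgout y fun h => hy (thickening_subset_cthickening _ _ h), ENNReal.ofReal_zero]
      exact zero_le
  calc directionalFlux μ ν v (cylinder v H (Set.Icc a b))
      ≤ ENNReal.ofReal (∫ x, f x * max ⟪v, ν x⟫ 0 ∂μ) := by rw [hlint v hv]; exact h1
    _ ≤ ENNReal.ofReal (∫ x, f x * max ⟪-v, ν x⟫ 0 ∂μ) + ENNReal.ofReal (∫ y, g y) :=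
        (ENNReal.ofReal_le_ofReal hle).trans ENNReal.ofReal_add_le
    _ ≤ _ := by rw [hlint (-v) hv']; exact add_le_add h2 h3

/-- The difference of the fluxes upwards and downwards through a cylinder is at most the measure of
its base. -/
theorem IsGaussGreenPair.directionalFlux_cylinder_le (hE : IsGaussGreenPair E μ ν)
    (hv : ‖v‖ = 1) {H : Set (ℝ ∙ v)ᗮ} (hH : IsCompact H) (a b : ℝ) :
    directionalFlux μ ν v (cylinder v H (Set.Icc a b)) ≤
      directionalFlux μ ν (-v) (cylinder v H (Set.Icc a b)) + volume H := by
  have := hE.isLocallyFiniteMeasure_directionalFlux (v := -v) (by rwa [norm_neg])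
  have h1 := tendsto_measure_biInter_gt (μ := directionalFlux μ ν (-v)) (a := (0 : ℝ))
    (s := fun r => cylinder v (cthickening r H) (Set.Icc (a - r) (b + r)))
    (fun r _ => (isClosed_cylinder isClosed_cthickening isClosed_Icc).measurableSet.nullMeasurableSet)
    (fun i j _ hij => cylinder_mono (cthickening_mono hij H)
      (Set.Icc_subset_Icc (by linarith) (by linarith)))
    ⟨1, one_pos, (isCompact_cylinder hv hH.cthickening isCompact_Icc).measure_lt_top.ne⟩
  have h2 : ⋂ r > (0 : ℝ), cylinder v (cthickening r H) (Set.Icc (a - r) (b + r)) =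
      cylinder v H (Set.Icc a b) := by
    refine Set.Subset.antisymm (fun x hx => ?_) (Set.subset_iInter₂ fun r hr => ?_)
    · simp only [Set.mem_iInter] at hx
      refine ⟨?_, le_of_forall_pos_sub_le fun r hr => (hx r hr).2.1,
        le_of_forall_pos_le_add fun r hr => (hx r hr).2.2⟩
      rw [← hH.isClosed.closure_eq, closure_eq_iInter_cthickening]
      simp only [Set.mem_iInter]
      exact fun r hr => (hx r hr).1
    · exact cylinder_mono (self_subset_cthickening H)
        (Set.Icc_subset_Icc (by linarith [hr.lt]) (by linarith [hr.lt]))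
  rw [h2] at h1
  have h3 := (tendsto_measure_cthickening_of_isCompact (μ := volume) hH).mono_left
    (nhdsWithin_le_nhds (s := Set.Ioi 0))
  refine ge_of_tendsto (h1.add h3) ?_
  filter_upwards [self_mem_nhdsWithin] with r hr
  exact hE.directionalFlux_cylinder_le_cthickening hv hH a b hr

end

/-! ### Comparison of the perimeter measure with the Hausdorff measure -/

section
variable {n : ℕ} {E : Set (EuclideanSpace ℝ (Fin n))}
  {μ : Measure (EuclideanSpace ℝ (Fin n))}
  {ν : EuclideanSpace ℝ (Fin n) → EuclideanSpace ℝ (Fin n)}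
  {v : EuclideanSpace ℝ (Fin n)}

/-- The orthogonal projection to a hyperplane is `1`-Lipschitz, hence does not increase the Hausdorff
measure, which on the hyperplane is Lebesgue measure. -/
theorem volume_orthogonalProjection_image_le (hv : ‖v‖ = 1) (S : Set (EuclideanSpace ℝ (Fin n))) :
    volume ((ℝ ∙ v)ᗮ.orthogonalProjectionOnto '' S) ≤ μHE[n - 1] S := by
  have hrank : Module.finrank ℝ (ℝ ∙ v)ᗮ = n - 1 := by
    have h := (ℝ ∙ v).finrank_add_finrank_orthogonal
    rw [finrank_span_singleton (by rintro rfl; simp at hv), finrank_euclideanSpace_fin] at h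
    omega
  have hL : LipschitzWith 1 (ℝ ∙ v)ᗮ.orthogonalProjectionOnto :=
    LipschitzWith.of_dist_le_mul fun x y => by
      rw [dist_eq_norm, dist_eq_norm, ← map_sub, NNReal.coe_one, one_mul]
      exact (ℝ ∙ v)ᗮ.norm_orthogonalProjectionOnto_apply_le (x - y)
  rw [← InnerProductSpace.euclideanHausdorffMeasure_eq_volume, hrank,
    Measure.euclideanHausdorffMeasure_def, Measure.euclideanHausdorffMeasure_def,
    Measure.smul_apply, Measure.smul_apply]
  gcongr
  simpa using hL.hausdorffMeasure_image_le (by positivity : (0 : ℝ) ≤ ((n - 1 : ℕ) : ℝ)) S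

/-- The estimate for cylinders localized to a set `S` in a small cylinder, by inner approximation of
`S` by compact sets `K` and consideration of the smallest cylinder containing `K`. -/
theorem IsGaussGreenPair.directionalFlux_le_of_subset_cylinder (hE : IsGaussGreenPair E μ ν)
    (hv : ‖v‖ = 1) {S : Set (EuclideanSpace ℝ (Fin n))} (hS : MeasurableSet S)
    {B : Set (ℝ ∙ v)ᗮ} {I : Set ℝ} (hI : I.OrdConnected) (hSB : S ⊆ cylinder v B I) :
    directionalFlux μ ν v S ≤ directionalFlux μ ν (-v) (cylinder v B I) + μHE[n - 1] S := by
  have := hE.isLocallyFiniteMeasure_directionalFlux hv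
  rw [hS.measure_eq_iSup_isCompact]
  refine iSup_le fun K => iSup_le fun hKS => iSup_le fun hK => ?_
  rcases K.eq_empty_or_nonempty with rfl | hne
  · simp
  obtain ⟨x, hx, hxmin⟩ := hK.exists_isMinOn hne (f := fun x => ⟪v, x⟫) (by fun_prop)
  obtain ⟨y, hy, hymax⟩ := hK.exists_isMaxOn hne (f := fun x => ⟪v, x⟫) (by fun_prop)
  set P := (ℝ ∙ v)ᗮ.orthogonalProjectionOnto with hP
  calc directionalFlux μ ν v K
      ≤ directionalFlux μ ν v (cylinder v (P '' K) (Set.Icc ⟪v, x⟫ ⟪v, y⟫)) :=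
        measure_mono fun z hz => ⟨⟨z, hz, rfl⟩, hxmin hz, hymax hz⟩
    _ ≤ directionalFlux μ ν (-v) (cylinder v (P '' K) (Set.Icc ⟪v, x⟫ ⟪v, y⟫)) +
          volume (P '' K) :=
        hE.directionalFlux_cylinder_le hv (hK.image P.continuous) _ _
    _ ≤ _ := by
        refine add_le_add (measure_mono (cylinder_mono ?_ ?_))
          ((volume_orthogonalProjection_image_le hv K).trans (measure_mono hKS))
        · rintro _ ⟨z, hz, rfl⟩
          exact (hSB (hKS hz)).1
        · exact hI.out (hSB (hKS hx)).2 (hSB (hKS hy)).2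

/-- A separable metric space is a countable disjoint union of measurable sets of small diameter. -/
theorem exists_measurable_partition_dist_lt (X : Type*) [MetricSpace X] [MeasurableSpace X]
    [BorelSpace X] [TopologicalSpace.SeparableSpace X] [Nonempty X] {r : ℝ} (hr : 0 < r) :
    ∃ V : ℕ → Set X, (∀ i, MeasurableSet (V i)) ∧ Pairwise (Function.onFun Disjoint V) ∧
      ⋃ i, V i = Set.univ ∧ ∀ i, ∀ x ∈ V i, ∀ y ∈ V i, dist x y < r := by
  refine ⟨disjointed fun i => ball (TopologicalSpace.denseSeq X i) (r / 2),
    MeasurableSet.disjointed fun i => measurableSet_ball, disjoint_disjointed _, ?_, ?_⟩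
  · rw [iUnion_disjointed, Set.eq_univ_iff_forall]
    intro x
    obtain ⟨i, hi⟩ := (TopologicalSpace.denseRange_denseSeq X).exists_dist_lt x (half_pos hr)
    exact Set.mem_iUnion.2 ⟨i, hi⟩
  · intro i x hx y hy
    have h1 := mem_ball.1
      (disjointed_subset (fun i => ball (TopologicalSpace.denseSeq X i) (r / 2)) i hx)
    have h2 := mem_ball.1
      (disjointed_subset (fun i => ball (TopologicalSpace.denseSeq X i) (r / 2)) i hy)
    linarith [dist_triangle_right x y (TopologicalSpace.denseSeq X i)]

/-- Where the normal has nonnegative component in the direction `v`, the flux in the direction `v` is at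
most the Hausdorff measure. The point is that the opposite flux vanishes there, so that it is small
in a neighbourhood; summing the estimate over small cylinders gives the result. -/
theorem IsGaussGreenPair.directionalFlux_le_euclideanHausdorffMeasure (hE : IsGaussGreenPair E μ ν)
    (hv : ‖v‖ = 1) {A : Set (EuclideanSpace ℝ (Fin n))} (hA : MeasurableSet A)
    (hAv : ∀ x ∈ A, 0 ≤ ⟪v, ν x⟫) : directionalFlux μ ν v A ≤ μHE[n - 1] A := by
  have := hE.isLocallyFiniteMeasure_directionalFlux hv
  have := hE.isLocallyFiniteMeasure_directionalFlux (v := -v) (by rwa [norm_neg])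
  rw [hA.measure_eq_iSup_isCompact]
  refine iSup_le fun K => iSup_le fun hKA => iSup_le fun hK => ?_
  refine le_trans ?_ (measure_mono hKA)
  refine ENNReal.le_of_forall_pos_le_add fun ε hε _ => ?_
  have hK0 : directionalFlux μ ν (-v) K = 0 := by
    rw [directionalFlux, withDensity_apply _ hK.measurableSet]
    refine (setLIntegral_congr_fun hK.measurableSet (g := 0) fun x hx => ?_).trans (by simp)
    have := hAv x (hKA hx)
    simpa using this
  obtain ⟨O, hKO, hO, hOε⟩ := K.exists_isOpen_le_add (directionalFlux μ ν (-v))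
    (ENNReal.coe_ne_zero.2 hε.ne')
  rw [hK0, zero_add] at hOε
  obtain ⟨r, hr, hrO⟩ := hK.exists_thickening_subset_open hO hKO
  obtain ⟨V, hVm, hVd, hVu, hVr⟩ := exists_measurable_partition_dist_lt (ℝ ∙ v)ᗮ (half_pos hr)
  set I : ℤ → Set ℝ := fun j => Set.Ioc (j • (r / 2)) ((j + 1) • (r / 2)) with hI
  have hId : Pairwise (Function.onFun Disjoint I) := Set.pairwise_disjoint_Ioc_zsmul _
  have hIu : ⋃ j, I j = Set.univ := iUnion_Ioc_zsmul (half_pos hr)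
  set Q : ℕ × ℤ → Set (EuclideanSpace ℝ (Fin n)) := fun p => cylinder v (V p.1) (I p.2) with hQ
  have hQm : ∀ p, MeasurableSet (Q p) := fun p => measurableSet_cylinder (hVm _) measurableSet_Ioc
  have hQd : Pairwise (Function.onFun Disjoint Q) := by
    intro p q hpq
    refine Set.disjoint_left.2 fun x hx hx' => hpq (Prod.ext ?_ ?_)
    · by_contra h
      exact Set.disjoint_left.1 (hVd h) hx.1 hx'.1
    · by_contra h
      exact Set.disjoint_left.1 (hId h) hx.2 hx'.2
  have hQu : ⋃ p, Q p = Set.univ := by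
    rw [Set.eq_univ_iff_forall]
    intro x
    obtain ⟨i, hi⟩ := Set.mem_iUnion.1 (hVu.ge (Set.mem_univ
      ((ℝ ∙ v)ᗮ.orthogonalProjectionOnto x)))
    obtain ⟨j, hj⟩ := Set.mem_iUnion.1 (hIu.ge (Set.mem_univ ⟪v, x⟫))
    exact Set.mem_iUnion.2 ⟨(i, j), hi, hj⟩
  have hQO : ∀ p, (K ∩ Q p).Nonempty → Q p ⊆ O := by
    rintro p ⟨x, hxK, hx⟩ y hy
    refine hrO (mem_thickening_iff.2 ⟨x, hxK, ?_⟩)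
    have h1 := hVr p.1 _ hy.1 _ hx.1
    have h2 : dist ⟪v, y⟫ ⟪v, x⟫ ≤ r / 2 := by
      have := Real.dist_le_of_mem_Icc (Set.Ioc_subset_Icc_self hy.2) (Set.Ioc_subset_Icc_self hx.2)
      simpa [add_mul] using this
    refine lt_of_pow_lt_pow_left₀ 2 hr.le ?_
    rw [dist_sq_eq_of_unit hv]
    have h3 : 0 ≤ dist ⟪v, y⟫ ⟪v, x⟫ := dist_nonneg
    have h4 : 0 ≤ dist ((ℝ ∙ v)ᗮ.orthogonalProjectionOnto y)
      ((ℝ ∙ v)ᗮ.orthogonalProjectionOnto x) := dist_nonneg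
    nlinarith
  have hcell : ∀ p, directionalFlux μ ν v (K ∩ Q p) ≤
      directionalFlux μ ν (-v) (O ∩ Q p) + μHE[n - 1] (K ∩ Q p) := by
    intro p
    rcases (K ∩ Q p).eq_empty_or_nonempty with h | h
    · simp [h]
    · rw [Set.inter_eq_right.2 (hQO p h)]
      exact hE.directionalFlux_le_of_subset_cylinder hv (hK.measurableSet.inter (hQm p))
        Set.ordConnected_Ioc Set.inter_subset_right
  have hsum : ∀ (m : Measure (EuclideanSpace ℝ (Fin n))) {S : Set (EuclideanSpace ℝ (Fin n))},
      MeasurableSet S → ∑' p, m (S ∩ Q p) = m S := by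
    intro m S hS
    rw [← measure_iUnion (fun p q hpq => (hQd hpq).mono Set.inter_subset_right
      Set.inter_subset_right) (fun p => hS.inter (hQm p)), ← Set.inter_iUnion, hQu, Set.inter_univ]
  calc directionalFlux μ ν v K = ∑' p, directionalFlux μ ν v (K ∩ Q p) :=
        (hsum _ hK.measurableSet).symm
    _ ≤ ∑' p, (directionalFlux μ ν (-v) (O ∩ Q p) + μHE[n - 1] (K ∩ Q p)) :=
        ENNReal.tsum_le_tsum hcell
    _ = directionalFlux μ ν (-v) O + μHE[n - 1] K := by
        rw [ENNReal.tsum_add, hsum _ hO.measurableSet, hsum _ hK.measurableSet]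
    _ ≤ μHE[n - 1] K + ε := by rw [add_comm]; gcongr

/-- The perimeter measure is dominated by the Hausdorff measure of codimension one. -/
theorem IsGaussGreenPair.le_euclideanHausdorffMeasure (hE : IsGaussGreenPair E μ ν)
    {A : Set (EuclideanSpace ℝ (Fin n))} (hA : MeasurableSet A) : μ A ≤ μHE[n - 1] A := by
  rcases isEmpty_or_nonempty (sphere (0 : EuclideanSpace ℝ (Fin n)) 1) with hemp | hne
  · have : μ = 0 := by
      rw [← ae_eq_bot, ← Filter.empty_mem_iff_bot]
      filter_upwards [hE.norm_eq_one] with x hx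
      exact hemp.elim ⟨ν x, by simpa using hx⟩
    simp [this]
  have hmul : ∀ t : ℝ≥0, t < 1 → (t : ℝ≥0∞) * μ A ≤ μHE[n - 1] A := by
    intro t ht
    -- divide `A` according to the direction of the normal
    obtain ⟨W, hWm, hWd, hWu, hWr⟩ := exists_measurable_partition_dist_lt
      (sphere (0 : EuclideanSpace ℝ (Fin n)) 1) (r := 1 - t) (by simpa using ht)
    have hW : ∀ i, ∃ B : Set (EuclideanSpace ℝ (Fin n)), MeasurableSet B ∧ Subtype.val ⁻¹' B = W i :=
      fun i => hWm i
    choose B hBm hB using hW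
    set N : ℕ → Set (EuclideanSpace ℝ (Fin n)) := fun i => A ∩ ν ⁻¹' (B i ∩ sphere 0 1) with hN
    have hNm : ∀ i, MeasurableSet (N i) := fun i =>
      hA.inter (hE.measurable ((hBm i).inter isClosed_sphere.measurableSet))
    have hNd : Pairwise (Function.onFun Disjoint N) := by
      intro i j hij
      refine Set.disjoint_left.2 fun x hx hx' => ?_
      have hi : (⟨ν x, hx.2.2⟩ : sphere (0 : EuclideanSpace ℝ (Fin n)) 1) ∈ W i := by
        rw [← hB i]; exact hx.2.1
      have hj : (⟨ν x, hx.2.2⟩ : sphere (0 : EuclideanSpace ℝ (Fin n)) 1) ∈ W j := by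
        rw [← hB j]; exact hx'.2.1
      exact Set.disjoint_left.1 (hWd hij) hi hj
    have hcover : A ≤ᵐ[μ] ⋃ i, N i := by
      refine hE.norm_eq_one.mono fun x hx hxA => ?_
      have hxs : ν x ∈ sphere (0 : EuclideanSpace ℝ (Fin n)) 1 := by simpa using hx
      obtain ⟨i, hi⟩ := Set.mem_iUnion.1 (hWu.ge (Set.mem_univ
        (⟨ν x, hxs⟩ : sphere (0 : EuclideanSpace ℝ (Fin n)) 1)))
      rw [← hB i] at hi
      exact Set.mem_iUnion.2 ⟨i, ⟨hxA, hi, hxs⟩⟩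
    have hpiece : ∀ i, (t : ℝ≥0∞) * μ (N i) ≤ μHE[n - 1] (N i) := by
      intro i
      rcases (N i).eq_empty_or_nonempty with h | ⟨z, hz⟩
      · simp [h]
      have hv : ‖ν z‖ = 1 := by simpa using hz.2.2
      have hinner : ∀ x ∈ N i, (t : ℝ) ≤ ⟪ν z, ν x⟫ := by
        intro x hx
        have h1 : dist (ν x) (ν z) < 1 - t := by
          refine hWr i ⟨ν x, hx.2.2⟩ ?_ ⟨ν z, hz.2.2⟩ ?_
          · rw [← hB i]; exact hx.2.1
          · rw [← hB i]; exact hz.2.1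
        have h2 := abs_real_inner_le_norm (ν z) (ν x - ν z)
        rw [hv, one_mul, inner_sub_right, real_inner_self_eq_norm_sq, hv] at h2
        rw [dist_eq_norm] at h1
        have := (abs_le.1 h2).1
        linarith
      refine le_trans ?_ (hE.directionalFlux_le_euclideanHausdorffMeasure hv (hNm i)
        fun x hx => t.coe_nonneg.trans (hinner x hx))
      rw [directionalFlux, withDensity_apply _ (hNm i), ← setLIntegral_const]
      refine setLIntegral_mono' (hNm i) fun x hx => ?_
      rw [← ENNReal.ofReal_coe_nnreal]
      exact ENNReal.ofReal_le_ofReal (hinner x hx)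
    calc (t : ℝ≥0∞) * μ A ≤ t * μ (⋃ i, N i) := mul_le_mul_right (measure_mono_ae hcover) _
      _ = ∑' i, t * μ (N i) := by rw [measure_iUnion hNd hNm, ENNReal.tsum_mul_left]
      _ ≤ ∑' i, μHE[n - 1] (N i) := ENNReal.tsum_le_tsum hpiece
      _ = μHE[n - 1] (⋃ i, N i) := (measure_iUnion hNd hNm).symm
      _ ≤ μHE[n - 1] A := measure_mono (Set.iUnion_subset fun i => Set.inter_subset_left)
  refine ENNReal.le_of_forall_lt_one_mul_le fun t ht => ?_
  lift t to ℝ≥0 using (ht.trans ENNReal.one_lt_top).ne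
  exact hmul t (by exact_mod_cast ht)

end

/-! ### Perimeter and translations -/

section
variable {n : ℕ} {E : Set (EuclideanSpace ℝ (Fin n))}

/-- Almost every point for the perimeter measure belongs to the reduced boundary, by the
Lebesgue–Besicovitch differentiation theorem. -/
theorem HasLocallyFinitePerimeter.ae_mem_reducedBoundary (h : HasLocallyFinitePerimeter E) :
    ∀ᵐ x ∂(perimeterMeasure h), x ∈ reducedBoundary h := by
  have hE : IsGaussGreenPair E (perimeterMeasure h) h.choose.2 := h.choose_spec
  have := hE.locallyFinite
  have hli : LocallyIntegrable h.choose.2 (perimeterMeasure h) := by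
    refine (locallyIntegrable_const (1 : ℝ)).mono hE.measurable.aestronglyMeasurable ?_
    filter_upwards [hE.norm_eq_one] with x hx
    simp [hx]
  have hsupp : ∀ᵐ x ∂(perimeterMeasure h), x ∈ (perimeterMeasure h).support :=
    Measure.support_mem_ae
  filter_upwards [(Besicovitch.vitaliFamily (perimeterMeasure h)).ae_tendsto_average hli,
    hE.norm_eq_one, hsupp] with x hx hx1 hxs
  refine ⟨fun r hr => ?_, h.choose.2 x, hx1,
    hx.comp (Besicovitch.tendsto_filterAt (perimeterMeasure h) x)⟩
  exact (Measure.mem_support_iff_forall x).1 hxs _ (closedBall_mem_nhds x hr)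

theorem norm_outerNormal_eq_one (h : HasLocallyFinitePerimeter E) {x : EuclideanSpace ℝ (Fin n)}
    (hx : x ∈ reducedBoundary h) : ‖outerNormal h x‖ = 1 := by
  obtain ⟨-, v, hv, hlim⟩ := hx
  rwa [outerNormal, hlim.limUnder_eq]

/-- The anisotropic perimeter controls the total mass of the perimeter measure. -/
theorem mul_perimeterMeasure_univ_le (h : HasLocallyFinitePerimeter E)
    {φ : Seminorm ℝ (EuclideanSpace ℝ (Fin n))} {c : ℝ} (hc : ∀ x, c * ‖x‖ ≤ φ x) :
    ENNReal.ofReal c * perimeterMeasure h Set.univ ≤ anisotropicPerimeter φ E := by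
  have hE : IsGaussGreenPair E (perimeterMeasure h) h.choose.2 := h.choose_spec
  -- a Borel subset of the reduced boundary of full measure
  set B := (toMeasurable (perimeterMeasure h) (reducedBoundary h)ᶜ)ᶜ with hB
  have hBm : MeasurableSet B := (measurableSet_toMeasurable _ _).compl
  have hBsub : B ⊆ reducedBoundary h := by
    rw [hB, Set.compl_subset_comm]
    exact subset_toMeasurable _ _
  have hBc : perimeterMeasure h Bᶜ = 0 := by
    rw [hB, compl_compl, measure_toMeasurable]
    exact h.ae_mem_reducedBoundary
  have hBu : perimeterMeasure h Set.univ = perimeterMeasure h B :=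
    measure_congr (eventuallyEq_univ.2 (compl_mem_ae_iff.1 (by rwa [mem_ae_iff, compl_compl]))).symm
  rw [anisotropicPerimeter, dif_pos h, hBu]
  calc ENNReal.ofReal c * perimeterMeasure h B
      ≤ ENNReal.ofReal c * μHE[n - 1] B :=
        mul_le_mul_right (hE.le_euclideanHausdorffMeasure hBm) _
    _ = ∫⁻ _ in B, ENNReal.ofReal c ∂(μHE[n - 1]) := (setLIntegral_const _ _).symm
    _ ≤ ∫⁻ x in B, ENNReal.ofReal (φ (outerNormal h x)) ∂(μHE[n - 1]) :=
        setLIntegral_mono' hBm fun x hx => ENNReal.ofReal_le_ofReal (by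
          simpa [norm_outerNormal_eq_one h (hBsub hx)] using hc (outerNormal h x))
    _ ≤ ∫⁻ x in reducedBoundary h, ENNReal.ofReal (φ (outerNormal h x)) ∂(μHE[n - 1]) :=
        lintegral_mono_set hBsub

variable {μ : Measure (EuclideanSpace ℝ (Fin n))}
  {ν : EuclideanSpace ℝ (Fin n) → EuclideanSpace ℝ (Fin n)}

/-- Translating a test function by `g` changes its integral over `E` by at most `|g|` times the
perimeter of `E`. -/
theorem IsGaussGreenPair.setIntegral_translate_sub_le (hE : IsGaussGreenPair E μ ν)
    [IsFiniteMeasure μ] {f : EuclideanSpace ℝ (Fin n) → ℝ} (hf : ContDiff ℝ 1 f)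
    (hfc : HasCompactSupport f) (hf1 : ∀ x, |f x| ≤ 1) (g : EuclideanSpace ℝ (Fin n)) :
    (∫ x in E, f (x + g)) - ∫ x in E, f x ≤ ‖g‖ * μ.real Set.univ := by
  obtain ⟨c, hc⟩ := (hf.continuous_fderiv one_ne_zero).bounded_above_of_compact_support
    (hfc.fderiv (𝕜 := ℝ))
  have hc0 : 0 ≤ c := (norm_nonneg _).trans (hc 0)
  have hderiv : ∀ s ∈ Set.Icc (0 : ℝ) 1, HasDerivAt (fun s : ℝ => ∫ x in E, f (x + s • g))
      (∫ x in E, fderiv ℝ f (x + s • g) g) s := by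
    intro s hs
    have hK : IsCompact (cthickening (2 * ‖g‖) (tsupport f)) := hfc.isCompact.cthickening
    refine (hasDerivAt_integral_of_dominated_loc_of_deriv_le
      (bound := (cthickening (2 * ‖g‖) (tsupport f)).indicator fun _ => c * ‖g‖)
      (F' := fun s x => fderiv ℝ f (x + s • g) g) (Ioo_mem_nhds (a := -1) (b := 2)
        (by linarith [hs.1]) (by linarith [hs.2])) ?_ ?_ ?_ ?_ ?_ ?_).2
    · exact Eventually.of_forall fun t =>
        (hf.continuous.comp (by fun_prop : Continuous fun x => x + t • g)).aestronglyMeasurable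
    · exact ((hf.continuous.integrable_of_hasCompactSupport hfc).comp_add_right (s • g)).integrableOn
    · exact Continuous.aestronglyMeasurable (((hf.continuous_fderiv one_ne_zero).comp
        (by fun_prop : Continuous fun x => x + s • g)).clm_apply continuous_const)
    · refine Eventually.of_forall fun x t ht => ?_
      by_cases hx : x ∈ cthickening (2 * ‖g‖) (tsupport f)
      · rw [Set.indicator_of_mem hx]
        exact ((fderiv ℝ f (x + t • g)).le_opNorm g).trans (by gcongr; exact hc _)
      · have h0 : fderiv ℝ f (x + t • g) = 0 := by
          by_contra h
          refine hx (mem_cthickening_of_dist_le x (x + t • g) _ _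
            (support_fderiv_subset ℝ (Function.mem_support.2 h)) ?_)
          rw [dist_self_add_right, norm_smul]
          gcongr
          rw [Real.norm_eq_abs, abs_le]
          constructor <;> linarith [ht.1, ht.2]
        rw [Set.indicator_of_notMem hx, h0]
        simp
    · exact ((integrable_indicator_iff hK.measurableSet).2
        (integrableOn_const hK.measure_lt_top.ne)).integrableOn
    · refine Eventually.of_forall fun x t _ => ?_
      have h1 : HasDerivAt (fun s : ℝ => x + s • g) g t := by
        simpa using ((hasDerivAt_id t).smul_const g).const_add x
      exact ((hf.differentiable one_ne_zero (x + t • g)).hasFDerivAt.comp_hasDerivAt t h1)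
  have hbound : ∀ s : ℝ, ‖∫ x in E, fderiv ℝ f (x + s • g) g‖ ≤ ‖g‖ * μ.real Set.univ := by
    intro s
    have h1 := hE.integral_fderiv (f := fun x => f (x + s • g)) (hf.comp (by fun_prop))
      (hfc.comp_homeomorph (Homeomorph.addRight (s • g))) g
    simp only [fderiv_comp_add_right] at h1
    rw [h1]
    refine norm_integral_le_of_norm_le_const ?_
    filter_upwards [hE.norm_eq_one] with x hx
    rw [norm_mul, Real.norm_eq_abs, Real.norm_eq_abs]
    calc |f (x + s • g)| * |⟪g, ν x⟫| ≤ 1 * (‖g‖ * ‖ν x‖) :=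
          mul_le_mul (hf1 _) (abs_real_inner_le_norm g (ν x)) (abs_nonneg _) zero_le_one
      _ = ‖g‖ := by rw [hx, one_mul, mul_one]
  have h := (convex_Icc (0 : ℝ) 1).norm_image_sub_le_of_norm_hasDerivWithin_le
    (fun s hs => (hderiv s hs).hasDerivWithinAt) (fun s _ => hbound s)
    (Set.left_mem_Icc.2 zero_le_one) (Set.right_mem_Icc.2 zero_le_one)
  simp only [one_smul, zero_smul, add_zero, sub_zero, norm_one, mul_one] at h
  exact (le_abs_self _).trans h

theorem le_setIntegral_of_eq_one {X : Type*} [MeasurableSpace X] {m : Measure X} {S K : Set X}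
    (hK : MeasurableSet K) (hKS : K ⊆ S) (hS : m S ≠ ∞) {F : X → ℝ} (hF : Integrable F m)
    (hF1 : ∀ x, -1 ≤ F x) (hFK : ∀ x ∈ K, F x = 1) :
    m.real K - m.real (S \ K) ≤ ∫ x in S, F x ∂m := by
  rw [← integral_inter_add_sdiff hK hF.integrableOn, Set.inter_eq_right.2 hKS,
    setIntegral_congr_fun hK hFK, sub_eq_add_neg]
  have hfin : m (S \ K) ≠ ∞ := measure_ne_top_of_subset Set.sdiff_subset hS
  refine add_le_add (by simp) ?_
  calc -m.real (S \ K) = ∫ x in S \ K, (-1 : ℝ) ∂m := by simp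
    _ ≤ ∫ x in S \ K, F x ∂m :=
      integral_mono (integrableOn_const hfin) hF.integrableOn hF1

/-- If `E` is disjoint from its translate by `g`, then `2 |E| = |E ∆ (E + g)| ≤ |g| Per(E)`. -/
theorem IsGaussGreenPair.two_mul_volume_le (hE : IsGaussGreenPair E μ ν) [IsFiniteMeasure μ]
    (hEm : NullMeasurableSet E) (hEf : volume E ≠ ∞) {g : EuclideanSpace ℝ (Fin n)}
    (hd : AEDisjoint volume ((fun x => x + g) '' E) E) :
    2 * volume.real E ≤ ‖g‖ * μ.real Set.univ := by
  set N := toMeasurable volume ((fun x => x + g) '' E ∩ E) with hN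
  have hN0 : volume N = 0 := by rw [hN, measure_toMeasurable]; exact hd
  obtain ⟨E', hE'sub, hE'm, hE'eq⟩ := hEm.exists_measurable_subset_ae_eq
  have hvol : volume (E' \ N) = volume E := by
    rw [measure_sdiff_null hN0, measure_congr hE'eq]
  refine le_of_forall_pos_le_add fun ε hε => ?_
  obtain ⟨K, hKsub, hK, hKlt⟩ := (hE'm.diff (measurableSet_toMeasurable _ _)).exists_isCompact_sdiff_lt
    (by rw [hvol]; exact hEf) (ε := ENNReal.ofReal (ε / 4))
    (by rw [ne_eq, ENNReal.ofReal_eq_zero, not_le]; positivity)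
  have hKE : K ⊆ E := fun x hx => hE'sub (hKsub hx).1
  have hEK : volume.real (E \ K) = volume.real E - volume.real K :=
    measureReal_sdiff hKE hK.measurableSet hEf
  have hsmall : volume.real E - volume.real K ≤ ε / 4 := by
    have h1 : volume.real ((E' \ N) \ K) = volume.real (E' \ N) - volume.real K :=
      measureReal_sdiff hKsub hK.measurableSet (by rw [hvol]; exact hEf)
    have h2 : volume.real (E' \ N) = volume.real E := by rw [measureReal_def, hvol, measureReal_def]
    rw [← h2, ← h1]
    exact ENNReal.toReal_le_of_le_ofReal (by positivity) hKlt.le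
  -- a test function close to `1` on `E + g` and to `-1` on `E`
  have hKg : IsCompact ((fun x => x + g) '' K) := hK.image (by fun_prop)
  have hdisj : Disjoint ((fun x => x + g) '' K) K := by
    refine Set.disjoint_left.2 ?_
    rintro _ ⟨x, hx, rfl⟩ hx'
    exact (hKsub hx').2 (subset_toMeasurable _ _ ⟨⟨x, hKE hx, rfl⟩, hKE hx'⟩)
  obtain ⟨r, hr, hrd⟩ := hdisj.exists_thickenings hKg hK.isClosed
  obtain ⟨f₁, hf₁, hf₁c, hf₁0, hf₁1, hf₁K, hf₁out⟩ := hKg.exists_contDiff_bump hr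
  obtain ⟨f₂, hf₂, hf₂c, hf₂0, hf₂1, hf₂K, hf₂out⟩ := hK.exists_contDiff_bump hr
  set f := fun x => f₁ x - f₂ x with hf
  have hfC : ContDiff ℝ 1 f := hf₁.sub hf₂
  have hfc : HasCompactSupport f := hf₁c.sub hf₂c
  have hf1 : ∀ x, |f x| ≤ 1 := fun x =>
    abs_le.2 ⟨by linarith [hf₁0 x, hf₂1 x], by linarith [hf₁1 x, hf₂0 x]⟩
  have hfi : Integrable f := hfC.continuous.integrable_of_hasCompactSupport hfc
  have h1 := le_setIntegral_of_eq_one hK.measurableSet hKE hEf (hfi.comp_add_right g)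
    (fun x => (abs_le.1 (hf1 _)).1) fun x hx => by
      have hxg : x + g ∈ (fun x => x + g) '' K := ⟨x, hx, rfl⟩
      simp only [hf]
      rw [hf₁K _ hxg, hf₂out _ (Set.disjoint_left.1 hrd (self_subset_thickening hr _ hxg)),
        sub_zero]
  have h2 := le_setIntegral_of_eq_one hK.measurableSet hKE hEf hfi.neg
    (fun x => neg_le_neg (abs_le.1 (hf1 x)).2) fun x hx => by
      simp only [Pi.neg_apply, hf]
      rw [hf₂K _ hx,
        hf₁out _ (Set.disjoint_right.1 hrd (self_subset_thickening hr _ hx))]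
      norm_num
  have h3 := hE.setIntegral_translate_sub_le hfC hfc hf1 g
  simp only [Pi.neg_apply, integral_neg] at h2
  linarith

end

/-! ### Packings, coverings and limits of lattices -/

section
variable {n : ℕ}

theorem infDist_add_of_mem {G : Submodule ℤ (EuclideanSpace ℝ (Fin n))}
    {g : EuclideanSpace ℝ (Fin n)} (hg : g ∈ G)
    (x : EuclideanSpace ℝ (Fin n)) : infDist (g + x) (G : Set _) = infDist x (G : Set _) := by
  have key : ∀ g ∈ G, ∀ x, infDist (g + x) (G : Set _) ≤ infDist x (G : Set _) := by
    intro g hg x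
    refine (le_infDist ⟨0, G.zero_mem⟩).2 fun {h} hh => ?_
    simpa using infDist_le_dist_of_mem (x := g + x) (G.add_mem hg hh)
  exact le_antisymm (key g hg x) (by simpa using key (-g) (G.neg_mem hg) (g + x))

section
variable {G : Submodule ℤ (EuclideanSpace ℝ (Fin n))} [DiscreteTopology G] [IsZLattice ℝ G]
  {D S : Set (EuclideanSpace ℝ (Fin n))}

/-- A set that is disjoint from its translates by nonzero lattice vectors has at most the volume of a
fundamental domain. -/
theorem measure_le_of_packing (hD : IsAddFundamentalDomain G D) (hS : MeasurableSet S)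
    (h : ∀ x ∈ S, ∀ g ∈ G, g + x ∈ S → g = 0) : volume S ≤ volume D := by
  have : MeasurableVAdd G (EuclideanSpace ℝ (Fin n)) :=
    (inferInstance : MeasurableVAdd G.toAddSubgroup (EuclideanSpace ℝ (Fin n)))
  have : VAddInvariantMeasure G (EuclideanSpace ℝ (Fin n)) volume :=
    (inferInstance : VAddInvariantMeasure G.toAddSubgroup (EuclideanSpace ℝ (Fin n)) volume)
  by_contra! hlt
  obtain ⟨x, hx, y, hy, g, hg, hgx⟩ := hD.exists_ne_zero_vadd_eq hS.nullMeasurableSet hlt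
  exact hg (Subtype.ext (h x hx g g.2 (by rw [← hgx] at hy; exact hy)))

/-- A set whose translates by lattice vectors cover the space has at least the volume of a
fundamental domain. -/
theorem measure_le_of_covering (hD : IsAddFundamentalDomain G D) (h : ∀ x, ∃ g ∈ G, x - g ∈ S) :
    volume D ≤ volume S := by
  have : MeasurableVAdd G (EuclideanSpace ℝ (Fin n)) :=
    (inferInstance : MeasurableVAdd G.toAddSubgroup (EuclideanSpace ℝ (Fin n)))
  have : VAddInvariantMeasure G (EuclideanSpace ℝ (Fin n)) volume :=
    (inferInstance : VAddInvariantMeasure G.toAddSubgroup (EuclideanSpace ℝ (Fin n)) volume)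
  rw [hD.measure_eq_tsum S]
  refine le_trans (measure_mono fun x hx => ?_) (measure_iUnion_le _)
  obtain ⟨g, hg, hgx⟩ := h x
  exact Set.mem_iUnion.2 ⟨⟨g, hg⟩, ⟨x - g, hgx, by simp [Submodule.vadd_def]⟩, hx⟩

/-- The covering radius of a lattice is bounded in terms of its packing radius and its covolume: on
the segment from `0` to a point far from the lattice there are points at distances
`0, δ, 2δ, …, Nδ` from the lattice, and the balls of radius `δ / 2` around them are disjoint modulo
the lattice. -/
theorem infDist_le_of_packing (hD : IsAddFundamentalDomain G D) {δ : ℝ} (hδ : 0 < δ)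
    (hG : ∀ g ∈ G, g ≠ 0 → δ ≤ ‖g‖) {N : ℕ}
    (hN : volume D < (N + 1 : ℕ) * volume (ball (0 : EuclideanSpace ℝ (Fin n)) (δ / 2)))
    (x : EuclideanSpace ℝ (Fin n)) : infDist x (G : Set _) ≤ N * δ := by
  by_contra! hlt
  have h0 : infDist (0 : EuclideanSpace ℝ (Fin n)) (G : Set _) = 0 :=
    infDist_zero_of_mem G.zero_mem
  have hpt : ∀ j : Fin (N + 1), ∃ y, infDist y (G : Set (EuclideanSpace ℝ (Fin n))) = j * δ := by
    intro j
    have hc : ContinuousOn (fun s : ℝ => infDist (s • x) (G : Set _)) (Set.Icc 0 1) :=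
      ((continuous_infDist_pt _).comp (by fun_prop)).continuousOn
    have hj : (j : ℝ) * δ ∈ Set.Icc (infDist ((0 : ℝ) • x) (G : Set (EuclideanSpace ℝ (Fin n))))
        (infDist ((1 : ℝ) • x) (G : Set (EuclideanSpace ℝ (Fin n)))) := by
      rw [zero_smul, one_smul, h0]
      refine ⟨by positivity, le_trans (mul_le_mul_of_nonneg_right ?_ hδ.le) hlt.le⟩
      exact_mod_cast Nat.lt_succ_iff.1 j.2
    obtain ⟨s, -, hs⟩ := intermediate_value_Icc zero_le_one hc hj
    exact ⟨s • x, hs⟩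
  choose y hy using hpt
  have hsep : ∀ j l : Fin (N + 1), ∀ g ∈ G, dist (g + y j) (y l) < δ → j = l := by
    intro j l g hg hd
    by_contra hne
    have h1 : |infDist (g + y j) (G : Set _) - infDist (y l) (G : Set _)| ≤ dist (g + y j) (y l) := by
      simpa [Real.dist_eq] using (lipschitz_infDist_pt (G : Set _)).dist_le_mul (g + y j) (y l)
    rw [infDist_add_of_mem hg, hy, hy, ← sub_mul, abs_mul, abs_of_pos hδ] at h1
    have h2 : (1 : ℝ) ≤ |(j : ℝ) - l| := by
      have : (1 : ℤ) ≤ |(j : ℤ) - l| := Int.one_le_abs (by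
        rw [sub_ne_zero]
        exact fun h => hne (Fin.ext (by exact_mod_cast h)))
      exact_mod_cast this
    nlinarith
  refine absurd (measure_le_of_packing hD (S := ⋃ j, ball (y j) (δ / 2))
    (MeasurableSet.iUnion fun j => measurableSet_ball) ?_) (not_le.2 ?_)
  · intro z hz g hg hgz
    obtain ⟨j, hj⟩ := Set.mem_iUnion.1 hz
    obtain ⟨l, hl⟩ := Set.mem_iUnion.1 hgz
    rw [mem_ball] at hj hl
    have h1 : dist (g + y j) (g + z) < δ / 2 := by rwa [dist_add_left, dist_comm]
    have h2 : j = l := hsep j l g hg (by linarith [dist_triangle (g + y j) (g + z) (y l)])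
    by_contra h0
    have h3 := hG g hg h0
    have h4 : dist (g + y j) (y j) < δ := by
      subst h2; linarith [dist_triangle (g + y j) (g + z) (y j)]
    rw [dist_eq_norm, add_sub_cancel_right] at h4
    linarith
  · rw [measure_iUnion _ fun j => measurableSet_ball]
    · simp only [Measure.addHaar_ball_center volume (y _)]
      simpa using hN
    · intro j l hjl
      refine ball_disjoint_ball ?_
      by_contra! h
      exact hjl (hsep j l 0 G.zero_mem (by simpa using h))

end

/-- Along a subsequence the distance functions of sets containing the origin converge pointwise:
they are `1`-Lipschitz, so it is enough to have convergence on a dense sequence. -/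
theorem exists_subseq_tendsto_infDist (A : ℕ → Set (EuclideanSpace ℝ (Fin n)))
    (hA : ∀ i, 0 ∈ A i) :
    ∃ k : ℕ → ℕ, StrictMono k ∧ ∃ d : EuclideanSpace ℝ (Fin n) → ℝ,
      ∀ x, Tendsto (fun i => infDist x (A (k i))) atTop (𝓝 (d x)) := by
  set q := TopologicalSpace.denseSeq (EuclideanSpace ℝ (Fin n)) with hq
  have hcpt : IsCompact (Set.univ.pi fun j => Set.Icc (0 : ℝ) ‖q j‖) :=
    isCompact_univ_pi fun j => isCompact_Icc
  obtain ⟨a, -, k, hk, hlim⟩ := hcpt.tendsto_subseq (x := fun i j => infDist (q j) (A i))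
    fun i j _ => ⟨infDist_nonneg, by simpa using infDist_le_dist_of_mem (x := q j) (hA i)⟩
  rw [tendsto_pi_nhds] at hlim
  refine ⟨k, hk, ?_⟩
  suffices h : ∀ x, ∃ c, Tendsto (fun i => infDist x (A (k i))) atTop (𝓝 c) from
    ⟨fun x => (h x).choose, fun x => (h x).choose_spec⟩
  intro x
  refine cauchySeq_tendsto_of_complete (Metric.cauchySeq_iff'.2 fun ε hε => ?_)
  obtain ⟨j, hj⟩ := (TopologicalSpace.denseRange_denseSeq
    (EuclideanSpace ℝ (Fin n))).exists_dist_lt x (by positivity : 0 < ε / 3)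
  obtain ⟨N, hN⟩ := Metric.cauchySeq_iff'.1 (hlim j).cauchySeq (ε / 3) (by positivity)
  refine ⟨N, fun i hi => ?_⟩
  have h1 : ∀ i, dist (infDist x (A i)) (infDist (q j) (A i)) < ε / 3 := fun i =>
    lt_of_le_of_lt (by simpa using (lipschitz_infDist_pt (A i)).dist_le_mul x (q j)) hj
  have h2 := hN i hi
  simp only [Function.comp] at h2
  have h3 := h1 (k N)
  rw [dist_comm] at h3
  linarith [dist_triangle4 (infDist x (A (k i))) (infDist (q j) (A (k i)))
    (infDist (q j) (A (k N))) (infDist x (A (k N))), h1 (k i)]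

/-- The limit of a sequence of lattices whose distance functions converge pointwise to `d`: the group
of zeros of `d`. -/
def limitLattice (Gs : ℕ → Submodule ℤ (EuclideanSpace ℝ (Fin n)))
    (d : EuclideanSpace ℝ (Fin n) → ℝ)
    (hd : ∀ x, Tendsto (fun i => infDist x (Gs i : Set (EuclideanSpace ℝ (Fin n)))) atTop (𝓝 (d x))) :
    Submodule ℤ (EuclideanSpace ℝ (Fin n)) :=
  AddSubgroup.toIntSubmodule
    { carrier := {x | d x = 0}
      zero_mem' := tendsto_nhds_unique (hd 0) (by
        simpa only [infDist_zero_of_mem (Submodule.zero_mem _)] using tendsto_const_nhds)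
      add_mem' := by
        intro x y hx hy
        have hxy := (hd x).add (hd y)
        rw [Set.mem_ofPred_eq] at hx hy
        rw [hx, hy, add_zero] at hxy
        refine tendsto_nhds_unique (hd _) (squeeze_zero (fun i => infDist_nonneg) (fun i => ?_) hxy)
        refine le_of_forall_pos_le_add fun ε hε => ?_
        have hne : (Gs i : Set (EuclideanSpace ℝ (Fin n))).Nonempty := ⟨0, Submodule.zero_mem _⟩
        obtain ⟨g, hg, hxg⟩ := (Metric.infDist_lt_iff hne).1
          (lt_add_of_pos_right (infDist x (Gs i : Set (EuclideanSpace ℝ (Fin n)))) (half_pos hε))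
        obtain ⟨h, hh, hyh⟩ := (Metric.infDist_lt_iff hne).1
          (lt_add_of_pos_right (infDist y (Gs i : Set (EuclideanSpace ℝ (Fin n)))) (half_pos hε))
        have h1 := infDist_le_dist_of_mem (x := x + y) ((Gs i).add_mem hg hh)
        have h2 := dist_add_add_le x y g h
        linarith
      neg_mem' := by
        intro x hx
        rw [Set.mem_ofPred_eq] at hx
        have h := hd x
        rw [hx] at h
        refine tendsto_nhds_unique (hd _) (squeeze_zero (fun i => infDist_nonneg) (fun i => ?_) h)
        refine (le_infDist ⟨0, Submodule.zero_mem _⟩).2 fun {g} hg => ?_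
        have h1 := infDist_le_dist_of_mem (x := -x) ((Gs i).neg_mem hg)
        rwa [dist_neg_neg] at h1 }

section
variable {Gs : ℕ → Submodule ℤ (EuclideanSpace ℝ (Fin n))} {d : EuclideanSpace ℝ (Fin n) → ℝ}
  (hd : ∀ x, Tendsto (fun i => infDist x (Gs i : Set (EuclideanSpace ℝ (Fin n)))) atTop (𝓝 (d x)))

theorem mem_limitLattice {x : EuclideanSpace ℝ (Fin n)} : x ∈ limitLattice Gs d hd ↔ d x = 0 :=
  Iff.rfl

theorem kuratowskiConverges_limitLattice : KuratowskiConverges Gs (limitLattice Gs d hd) := by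
  constructor
  · ext x
    rw [Set.mem_ofPred_eq, (hd x).limsup_eq]
    exact mem_limitLattice hd
  · ext x
    rw [Set.mem_ofPred_eq, (hd x).liminf_eq]
    exact mem_limitLattice hd

theorem exists_tendsto_of_mem_limitLattice {x : EuclideanSpace ℝ (Fin n)}
    (hx : x ∈ limitLattice Gs d hd) :
    ∃ g : ℕ → EuclideanSpace ℝ (Fin n), (∀ i, g i ∈ Gs i) ∧ Tendsto g atTop (𝓝 x) := by
  have h : ∀ i : ℕ, ∃ g ∈ Gs i, dist x g < infDist x (Gs i : Set (EuclideanSpace ℝ (Fin n))) +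
      1 / ((i : ℝ) + 1) := fun i =>
    (Metric.infDist_lt_iff ⟨0, Submodule.zero_mem _⟩).1 (lt_add_of_pos_right _ (by positivity))
  choose g hg hgx using h
  refine ⟨g, hg, tendsto_iff_dist_tendsto_zero.2 ?_⟩
  have hlim := (hd x).add tendsto_one_div_add_atTop_nhds_zero_nat
  rw [(mem_limitLattice hd).1 hx, zero_add] at hlim
  exact squeeze_zero (fun i => dist_nonneg) (fun i => by rw [dist_comm]; exact (hgx i).le) hlim

theorem mem_limitLattice_of_tendsto {g : ℕ → EuclideanSpace ℝ (Fin n)} {k : ℕ → ℕ}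
    (hk : Tendsto k atTop atTop) (hg : ∀ i, g i ∈ Gs (k i)) {x : EuclideanSpace ℝ (Fin n)}
    (hx : Tendsto g atTop (𝓝 x)) : x ∈ limitLattice Gs d hd := by
  refine tendsto_nhds_unique ((hd x).comp hk) (squeeze_zero (fun i => infDist_nonneg) (fun i => ?_)
    (tendsto_iff_dist_tendsto_zero.1 hx))
  rw [dist_comm]
  exact infDist_le_dist_of_mem (hg i)

theorem le_norm_of_mem_limitLattice {δ : ℝ}
    (hG : ∀ i, ∀ g ∈ Gs i, g ≠ 0 → δ ≤ ‖g‖) {x : EuclideanSpace ℝ (Fin n)}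
    (hx : x ∈ limitLattice Gs d hd) (hx0 : x ≠ 0) : δ ≤ ‖x‖ := by
  obtain ⟨g, hg, hlim⟩ := exists_tendsto_of_mem_limitLattice hd hx
  refine ge_of_tendsto hlim.norm ?_
  filter_upwards [hlim.eventually_ne hx0] with i hi using hG i _ (hg i) hi

theorem exists_dist_le_of_limitLattice {R : ℝ}
    (hR : ∀ i x, infDist x (Gs i : Set (EuclideanSpace ℝ (Fin n))) < R)
    (x : EuclideanSpace ℝ (Fin n)) : ∃ g ∈ limitLattice Gs d hd, dist g x ≤ R := by
  have h : ∀ i, ∃ g ∈ Gs i, dist x g < R := fun i =>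
    (Metric.infDist_lt_iff ⟨0, Submodule.zero_mem _⟩).1 (hR i x)
  choose g hg hgx using h
  obtain ⟨y, hy, k, hk, hlim⟩ := (isCompact_closedBall x R).tendsto_subseq
    (x := g) fun i => by rw [mem_closedBall, dist_comm]; exact (hgx i).le
  exact ⟨y, mem_limitLattice_of_tendsto hd hk.tendsto_atTop (fun i => hg _) hlim, hy⟩

theorem isLattice_of_le_norm_of_dist_le {G : Submodule ℤ (EuclideanSpace ℝ (Fin n))} {δ R : ℝ}
    (hδ : 0 < δ) (hG : ∀ g ∈ G, g ≠ 0 → δ ≤ ‖g‖) (hR : ∀ x, ∃ g ∈ G, dist g x ≤ R) :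
    IsLattice G := by
  constructor
  · refine DiscreteTopology.of_forall_le_dist hδ fun x y hxy => ?_
    change δ ≤ dist x y
    rw [Subtype.dist_eq, dist_eq_norm]
    exact hG _ (G.sub_mem x.2 y.2) (sub_ne_zero.2 fun h => hxy (Subtype.ext h))
  · set W := Submodule.span ℝ (G : Set (EuclideanSpace ℝ (Fin n))) with hW
    rw [← Submodule.orthogonal_eq_bot_iff, Submodule.eq_bot_iff]
    intro x hx
    by_contra hx0
    have hxp : 0 < ‖x‖ := norm_pos_iff.2 hx0
    -- a vector orthogonal to the span is as far from the lattice as from the origin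
    have hfar : ∀ t : ℝ, |t| * ‖x‖ ≤ R := by
      intro t
      obtain ⟨g, hg, hgx⟩ := hR (t • x)
      have hort : ⟪g, t • x⟫ = 0 := by
        rw [real_inner_smul_right, (Submodule.mem_orthogonal W x).1 hx g (Submodule.subset_span hg),
          mul_zero]
      have h1 := norm_sub_sq_real g (t • x)
      rw [hort, norm_smul, Real.norm_eq_abs] at h1
      rw [dist_eq_norm] at hgx
      refine le_trans (abs_le_of_sq_le_sq' ?_ (norm_nonneg (g - t • x))).2 hgx
      nlinarith [sq_nonneg ‖g‖]
    have h := hfar ((R + 1) / ‖x‖)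
    have h2 := mul_le_mul_of_nonneg_right (le_abs_self ((R + 1) / ‖x‖)) hxp.le
    rw [div_mul_cancel₀ _ hxp.ne'] at h2
    linarith

end

end

/-! ### Compactness of lattices of fixed volume -/

section
variable {n : ℕ} {Gs : ℕ → Submodule ℤ (EuclideanSpace ℝ (Fin n))}
  {Ds : ℕ → Set (EuclideanSpace ℝ (Fin n))} {d : EuclideanSpace ℝ (Fin n) → ℝ}
  (hd : ∀ x, Tendsto (fun i => infDist x (Gs i : Set (EuclideanSpace ℝ (Fin n)))) atTop (𝓝 (d x)))
  {V : ℝ≥0∞}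

/-- A compact packing of the limit lattice is a packing of some lattice of the sequence. -/
theorem measure_le_of_packing_limitLattice (hGs : ∀ i, IsLattice (Gs i))
    (hDs : ∀ i, IsAddFundamentalDomain (Gs i) (Ds i)) (hV : ∀ i, volume (Ds i) = V)
    {δ : ℝ} (hδ : 0 < δ) (hsep : ∀ i, ∀ g ∈ Gs i, g ≠ 0 → δ ≤ ‖g‖)
    {K : Set (EuclideanSpace ℝ (Fin n))} (hK : IsCompact K)
    (h : ∀ x ∈ K, ∀ g ∈ limitLattice Gs d hd, g + x ∈ K → g = 0) : volume K ≤ V := by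
  suffices hex : ∃ i, ∀ x ∈ K, ∀ g ∈ Gs i, g + x ∈ K → g = 0 by
    obtain ⟨i, hi⟩ := hex
    have := (hGs i).1
    have : IsZLattice ℝ (Gs i) := ⟨(hGs i).2⟩
    rw [← hV i]
    exact measure_le_of_packing (hDs i) hK.measurableSet hi
  by_contra! hcon
  choose x hx g hg hgx hg0 using hcon
  obtain ⟨a, ha, k, hk, hxlim⟩ := hK.tendsto_subseq hx
  obtain ⟨b, hb, l, hl, hylim⟩ := hK.tendsto_subseq (x := fun i => g (k i) + x (k i))
    fun i => hgx (k i)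
  have hglim : Tendsto (fun i => g (k (l i))) atTop (𝓝 (b - a)) := by
    have := hylim.sub (hxlim.comp hl.tendsto_atTop)
    simpa [Function.comp_def] using this
  have hmem : b - a ∈ limitLattice Gs d hd :=
    mem_limitLattice_of_tendsto hd (hk.comp hl).tendsto_atTop (fun i => hg _) hglim
  have h0 : b - a = 0 := h a ha _ hmem (by simpa using hb)
  have hnorm : δ ≤ ‖b - a‖ :=
    ge_of_tendsto hglim.norm (Eventually.of_forall fun i => hsep _ _ (hg _) (hg0 _))
  rw [h0, norm_zero] at hnorm
  linarith

/-- Every neighbourhood of a compact covering for the limit lattice is a covering for some lattice of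
the sequence. -/
theorem measure_le_of_covering_limitLattice (hGs : ∀ i, IsLattice (Gs i))
    (hDs : ∀ i, IsAddFundamentalDomain (Gs i) (Ds i)) (hV : ∀ i, volume (Ds i) = V)
    {R : ℝ} (hR : ∀ i x, infDist x (Gs i : Set (EuclideanSpace ℝ (Fin n))) < R)
    {K : Set (EuclideanSpace ℝ (Fin n))} (hK : IsCompact K)
    (h : ∀ x, ∃ g ∈ limitLattice Gs d hd, x - g ∈ K) : V ≤ volume K := by
  have hlim : Tendsto (fun r => volume (cthickening r K)) (𝓝[>] 0) (𝓝 (volume K)) :=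
    (tendsto_measure_cthickening_of_isCompact hK).mono_left nhdsWithin_le_nhds
  refine ge_of_tendsto hlim ?_
  filter_upwards [self_mem_nhdsWithin] with r hr
  suffices hex : ∃ i, ∀ x, ∃ g ∈ Gs i, x - g ∈ cthickening r K by
    obtain ⟨i, hi⟩ := hex
    have := (hGs i).1
    have : IsZLattice ℝ (Gs i) := ⟨(hGs i).2⟩
    rw [← hV i]
    exact measure_le_of_covering (hDs i) hi
  by_contra! hcon
  choose x hx using hcon
  -- the uncovered points can be translated into a fixed ball
  have htr : ∀ i, ∃ g ∈ Gs i, dist (x i) g < R := fun i =>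
    (Metric.infDist_lt_iff ⟨0, Submodule.zero_mem _⟩).1 (hR i (x i))
  choose t ht htx using htr
  obtain ⟨y, -, k, hk, hy⟩ := (isCompact_closedBall (0 : EuclideanSpace ℝ (Fin n)) R).tendsto_subseq
    (x := fun i => x i - t i) fun i => by
      rw [mem_closedBall, dist_zero_right, ← dist_eq_norm]; exact (htx i).le
  obtain ⟨a, ha, hya⟩ := h y
  obtain ⟨g, hg, hga⟩ := exists_tendsto_of_mem_limitLattice hd ha
  have hlim2 : Tendsto (fun i => x (k i) - t (k i) - g (k i)) atTop (𝓝 (y - a)) :=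
    hy.sub (hga.comp hk.tendsto_atTop)
  obtain ⟨i, hi⟩ := (hlim2.eventually (ball_mem_nhds (y - a) hr)).exists
  refine hx (k i) (t (k i) + g (k i)) ((Gs _).add_mem (ht _) (hg _)) ?_
  rw [← sub_sub]
  exact mem_cthickening_of_dist_le _ _ _ _ hya (mem_ball.1 hi).le

/-- The covolume is continuous along convergent sequences of lattices with uniform packing and
covering radii. -/
theorem covolume_limitLattice (hGs : ∀ i, IsLattice (Gs i))
    (hDs : ∀ i, IsAddFundamentalDomain (Gs i) (Ds i)) (hV : ∀ i, volume (Ds i) = V)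
    {δ : ℝ} (hδ : 0 < δ) (hsep : ∀ i, ∀ g ∈ Gs i, g ≠ 0 → δ ≤ ‖g‖)
    {R : ℝ} (hR : ∀ i x, infDist x (Gs i : Set (EuclideanSpace ℝ (Fin n))) < R)
    (hL : IsLattice (limitLattice Gs d hd)) :
    ZLattice.covolume (limitLattice Gs d hd) = V.toReal := by
  set L := limitLattice Gs d hd with hLdef
  have := hL.1
  have : IsZLattice ℝ L := ⟨hL.2⟩
  set b := (Module.Free.chooseBasis ℤ L).ofZLatticeBasis ℝ L with hb
  have hspan : ∀ g, g ∈ Submodule.span ℤ (Set.range b) ↔ g ∈ L := by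
    intro g
    rw [hb, Module.Basis.ofZLatticeBasis_span]
  have hfund : IsAddFundamentalDomain L (ZSpan.fundamentalDomain b) :=
    ZLattice.isAddFundamentalDomain (Module.Free.chooseBasis ℤ L) volume
  rw [ZLattice.covolume_eq_measure_fundamentalDomain L volume hfund, measureReal_def]
  congr 1
  refine le_antisymm ?_ ?_
  · rw [(ZSpan.fundamentalDomain_measurableSet b).measure_eq_iSup_isCompact]
    refine iSup_le fun K => iSup_le fun hKF => iSup_le fun hK => ?_
    refine measure_le_of_packing_limitLattice hd hGs hDs hV hδ hsep hK fun x hx g hg hgx => ?_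
    obtain ⟨w, -, hw⟩ := ZSpan.exist_unique_vadd_mem_fundamentalDomain b x
    have h0 : (0 : Submodule.span ℤ (Set.range b)) = w := hw 0 (by simpa using hKF hx)
    have h1 : (⟨g, (hspan g).2 hg⟩ : Submodule.span ℤ (Set.range b)) = w := hw _ (hKF hgx)
    simpa using congrArg Subtype.val (h1.trans h0.symm)
  · rw [measure_congr (ZSpan.fundamentalDomain_ae_parallelepiped b volume)]
    refine measure_le_of_covering_limitLattice hd hGs hDs hV hR
      b.parallelepiped.isCompact fun x => ?_
    obtain ⟨w, hw, -⟩ := ZSpan.exist_unique_vadd_mem_fundamentalDomain b x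
    refine ⟨-w, L.neg_mem ((hspan _).1 w.2), ZSpan.fundamentalDomain_subset_parallelepiped b ?_⟩
    rw [sub_neg_eq_add, add_comm]
    exact hw

end

/-- Mahler's compactness theorem: a sequence of lattices of fixed covolume whose minimal distances
are bounded from below has a subsequence converging to a lattice of the same covolume. -/
theorem exists_subseq_kuratowskiConverges {n : ℕ} {m : ℝ} (hm : 0 < m)
    {G : ℕ → Submodule ℤ (EuclideanSpace ℝ (Fin n))} (hG : ∀ i, G i ∈ latticesOfVolume n m)
    {δ : ℝ} (hδ : 0 < δ) (hsep : ∀ i, ∀ g ∈ G i, g ≠ 0 → δ ≤ ‖g‖) :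
    ∃ k : ℕ → ℕ, StrictMono k ∧ ∃ G' ∈ latticesOfVolume n m,
      KuratowskiConverges (fun i => G (k i)) G' := by
  have hfund : ∀ i, ∃ D : Set (EuclideanSpace ℝ (Fin n)), IsAddFundamentalDomain (G i) D ∧
      volume D = ENNReal.ofReal m := by
    intro i
    obtain ⟨⟨h1, h2⟩, h3⟩ := hG i
    have : IsZLattice ℝ (G i) := ⟨h2⟩
    have hf := ZLattice.isAddFundamentalDomain (Module.Free.chooseBasis ℤ (G i))
      (volume : Measure (EuclideanSpace ℝ (Fin n)))
    refine ⟨_, hf, ?_⟩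
    rw [ZLattice.covolume_eq_measure_fundamentalDomain (G i) volume hf, measureReal_def] at h3
    rw [← h3, ENNReal.ofReal_toReal]
    intro htop
    rw [htop, ENNReal.toReal_top] at h3
    exact hm.ne h3
  choose D hD hDm using hfund
  -- a covering radius common to all the lattices
  obtain ⟨N, hN⟩ : ∃ N : ℕ, ENNReal.ofReal m <
      (N + 1 : ℕ) * volume (ball (0 : EuclideanSpace ℝ (Fin n)) (δ / 2)) := by
    have hball : volume (ball (0 : EuclideanSpace ℝ (Fin n)) (δ / 2)) ≠ 0 :=
      (measure_ball_pos volume _ (half_pos hδ)).ne'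
    obtain ⟨N, hN⟩ := ENNReal.exists_nat_mul_gt hball (ENNReal.ofReal_ne_top (r := m))
    exact ⟨N, hN.trans_le (by gcongr; omega)⟩
  have hR : ∀ i x, infDist x (G i : Set (EuclideanSpace ℝ (Fin n))) < N * δ + 1 := by
    intro i x
    have := (hG i).1.1
    have : IsZLattice ℝ (G i) := ⟨(hG i).1.2⟩
    exact lt_of_le_of_lt (infDist_le_of_packing (hD i) hδ (hsep i) (by rw [hDm]; exact hN) x)
      (lt_add_one _)
  obtain ⟨k, hk, d, hd⟩ := exists_subseq_tendsto_infDist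
    (fun i => (G i : Set (EuclideanSpace ℝ (Fin n)))) fun i => (G i).zero_mem
  have hL : IsLattice (limitLattice (fun i => G (k i)) d hd) :=
    isLattice_of_le_norm_of_dist_le hδ
      (fun g hg hg0 => le_norm_of_mem_limitLattice hd (fun i => hsep (k i)) hg hg0)
      (exists_dist_le_of_limitLattice hd fun i => hR (k i))
  refine ⟨k, hk, limitLattice (fun i => G (k i)) d hd, ⟨hL, ?_⟩, kuratowskiConverges_limitLattice hd⟩
  rw [covolume_limitLattice hd (fun i => (hG (k i)).1) (fun i => hD (k i)) (fun i => hDm (k i)) hδ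
    (fun i => hsep (k i)) (fun i => hR (k i)) hL, ENNReal.toReal_ofReal hm.le]

/-- A norm on `ℝⁿ` is at least a positive multiple of the Euclidean norm; for the Euclidean norm
itself the constant is taken to be one. -/
theorem exists_mul_norm_le_seminorm {n : ℕ} {φ : Seminorm ℝ (EuclideanSpace ℝ (Fin n))}
    (hφ : ∀ x, φ x = 0 → x = 0) :
    ∃ c : ℝ, 0 < c ∧ (φ = normSeminorm ℝ (EuclideanSpace ℝ (Fin n)) → c = 1) ∧
      ∀ x, c * ‖x‖ ≤ φ x := by
  by_cases hnorm : φ = normSeminorm ℝ (EuclideanSpace ℝ (Fin n))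
  · exact ⟨1, one_pos, fun _ => rfl, fun x => by simp [hnorm]⟩
  have hcont : Continuous φ := φ.convexOn.locallyLipschitz.continuous
  rcases (sphere (0 : EuclideanSpace ℝ (Fin n)) 1).eq_empty_or_nonempty with hemp | hne
  · refine ⟨1, one_pos, fun _ => rfl, fun x => ?_⟩
    have hx : x = 0 := by
      by_contra hx0
      have : ‖x‖⁻¹ • x ∈ sphere (0 : EuclideanSpace ℝ (Fin n)) 1 := by
        simp [norm_smul, norm_ne_zero_iff.2 hx0]
      rw [hemp] at this
      exact this
    simp [hx]
  obtain ⟨z, hz, hmin⟩ := (isCompact_sphere (0 : EuclideanSpace ℝ (Fin n)) 1).exists_isMinOn hne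
    hcont.continuousOn
  have hz0 : z ≠ 0 := fun h => by simp [h] at hz
  refine ⟨φ z, lt_of_le_of_ne (apply_nonneg φ z) fun h => hz0 (hφ z h.symm), fun h => absurd h hnorm,
    fun x => ?_⟩
  rcases eq_or_ne x 0 with rfl | hx0
  · simp
  have hx : ‖x‖⁻¹ • x ∈ sphere (0 : EuclideanSpace ℝ (Fin n)) 1 := by
    simp [norm_smul, norm_ne_zero_iff.2 hx0]
  have h1 : φ z ≤ φ (‖x‖⁻¹ • x) := hmin hx
  rw [map_smul_eq_mul, Real.norm_eq_abs, abs_of_nonneg (by positivity), inv_mul_eq_div,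
    le_div_iff₀ (norm_pos_iff.2 hx0)] at h1
  exact h1

/-- A lattice with a fundamental domain of bounded perimeter has no short nonzero vectors. -/
theorem le_norm_of_anisotropicPerimeter_le {n : ℕ} {φ : Seminorm ℝ (EuclideanSpace ℝ (Fin n))}
    {c m C : ℝ} (hc0 : 0 < c) (hc : ∀ x, c * ‖x‖ ≤ φ x) (hm : 0 < m) (hC : 0 < C)
    {G : Submodule ℤ (EuclideanSpace ℝ (Fin n))} (hG : G ∈ latticesOfVolume n m)
    {D : Set (EuclideanSpace ℝ (Fin n))} (hD : IsAddFundamentalDomain G D)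
    (hP : anisotropicPerimeter φ D ≤ ENNReal.ofReal C) {g : EuclideanSpace ℝ (Fin n)} (hg : g ∈ G)
    (hg0 : g ≠ 0) : 2 * m * c / C ≤ ‖g‖ := by
  obtain ⟨⟨hdisc, hspan⟩, hcov⟩ := hG
  have : IsZLattice ℝ G := ⟨hspan⟩
  have hvol : volume.real D = m := by
    rw [← hcov, ZLattice.covolume_eq_measure_fundamentalDomain G volume hD]
  have hfin : volume D ≠ ∞ := fun h => by
    rw [measureReal_def, h, ENNReal.toReal_top] at hvol
    exact hm.ne hvol
  have hE : HasLocallyFinitePerimeter D := by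
    by_contra h
    rw [anisotropicPerimeter, dif_neg h] at hP
    exact absurd hP (not_le.2 ENNReal.ofReal_lt_top)
  have hmass : perimeterMeasure hE Set.univ ≤ ENNReal.ofReal (C / c) := by
    have h := (mul_perimeterMeasure_univ_le hE hc).trans hP
    rw [ENNReal.ofReal_div_of_pos hc0, ENNReal.le_div_iff_mul_le
      (Or.inl (by simpa using hc0)) (Or.inl ENNReal.ofReal_ne_top), mul_comm]
    exact h
  have : IsFiniteMeasure (perimeterMeasure hE) := ⟨hmass.trans_lt ENNReal.ofReal_lt_top⟩
  have hpair : IsGaussGreenPair D (perimeterMeasure hE) hE.choose.2 := hE.choose_spec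
  have hdisj : AEDisjoint volume ((fun x => x + g) '' D) D := by
    have h := hD.aedisjoint (i := ⟨g, hg⟩) (j := 0) (fun h => hg0 (congrArg Subtype.val h))
    have h1 : (⟨g, hg⟩ : G) +ᵥ D = (fun x => x + g) '' D := by
      ext x
      simp only [Set.mem_vadd_set, Set.mem_image, Submodule.vadd_def, vadd_eq_add, add_comm]
    have h2 : (0 : G) +ᵥ D = D := zero_vadd G D
    change AEDisjoint volume ((⟨g, hg⟩ : G) +ᵥ D) ((0 : G) +ᵥ D) at h
    rwa [h1, h2] at h
  have h1 := hpair.two_mul_volume_le hD.nullMeasurableSet hfin hdisj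
  have h2 : (perimeterMeasure hE).real Set.univ ≤ C / c :=
    ENNReal.toReal_le_of_le_ofReal (by positivity) hmass
  rw [hvol] at h1
  have h3 : 2 * m ≤ ‖g‖ * (C / c) := h1.trans (by gcongr)
  rw [div_le_iff₀ hC]
  rw [mul_div_assoc', le_div_iff₀ hc0] at h3
  exact h3

/-- As `n ≥ 1`, the infimum defining `minDistance` is not taken over the empty set. -/
theorem le_minDistance {n : ℕ} (hn : 1 ≤ n) {G : Submodule ℤ (EuclideanSpace ℝ (Fin n))}
    (hG : IsLattice G) {δ : ℝ} (h : ∀ g ∈ G, g ≠ 0 → δ ≤ ‖g‖) : δ ≤ minDistance G := by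
  refine le_csInf ?_ ?_
  · have hbot : G ≠ ⊥ := by
      rintro rfl
      have h2 := hG.2
      have : Nonempty (Fin n) := ⟨⟨0, hn⟩⟩
      rw [Submodule.bot_coe, Submodule.span_zero_singleton] at h2
      exact bot_ne_top h2
    obtain ⟨g, hg, hg0⟩ := Submodule.exists_mem_ne_zero_of_ne_bot hbot
    exact ⟨‖g‖, g, hg, hg0, rfl⟩
  · rintro _ ⟨g, hg, hg0, rfl⟩
    exact h g hg hg0

theorem proposition3p1 (n : ℕ) (hn : 1 ≤ n)
    (φ : Seminorm ℝ (EuclideanSpace ℝ (Fin n))) (hφ : ∀ x, φ x = 0 → x = 0)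
    (m C : ℝ) (hm : 0 < m) (hC : 0 < C) :
    (∃ δ : ℝ, 0 < δ ∧
      (φ = normSeminorm ℝ (EuclideanSpace ℝ (Fin n)) → δ = 2 * m / C) ∧
      ∀ (G : ℕ → Submodule ℤ (EuclideanSpace ℝ (Fin n)))
        (D : ℕ → Set (EuclideanSpace ℝ (Fin n))),
        (∀ i, G i ∈ latticesOfVolume n m) →
        (∀ i, IsAddFundamentalDomain (G i) (D i)) →
        (∀ i, anisotropicPerimeter φ (D i) ≤ ENNReal.ofReal C) →
        ∀ i, δ ≤ minDistance (G i)) ∧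
    (∀ (G : ℕ → Submodule ℤ (EuclideanSpace ℝ (Fin n)))
        (D : ℕ → Set (EuclideanSpace ℝ (Fin n))),
        (∀ i, G i ∈ latticesOfVolume n m) →
        (∀ i, IsAddFundamentalDomain (G i) (D i)) →
        (∀ i, anisotropicPerimeter φ (D i) ≤ ENNReal.ofReal C) →
        ∃ k : ℕ → ℕ, StrictMono k ∧ ∃ G' ∈ latticesOfVolume n m,
          KuratowskiConverges (fun i => G (k i)) G') := by
  obtain ⟨c, hc0, hc1, hc⟩ := exists_mul_norm_le_seminorm hφ
  have hδ : 0 < 2 * m * c / C := by positivity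
  have hsep := fun (G : ℕ → Submodule ℤ (EuclideanSpace ℝ (Fin n)))
    (D : ℕ → Set (EuclideanSpace ℝ (Fin n)))
    (hG : ∀ i, G i ∈ latticesOfVolume n m)
    (hD : ∀ i, IsAddFundamentalDomain (G i) (D i))
    (hP : ∀ i, anisotropicPerimeter φ (D i) ≤ ENNReal.ofReal C) i g (hg : g ∈ G i) (hg0 : g ≠ 0) =>
      le_norm_of_anisotropicPerimeter_le hc0 hc hm hC (hG i) (hD i) (hP i) hg hg0
  refine ⟨⟨2 * m * c / C, hδ, fun h => by rw [hc1 h, mul_one], fun G D hG hD hP i =>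
    le_minDistance hn (hG i).1 (hsep G D hG hD hP i)⟩, fun G D hG hD hP =>
    exists_subseq_kuratowskiConverges hm hG hδ (hsep G D hG hD hP)⟩
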